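/- Links are unoriented and are represented by diagrams, considered up to planar isotopy and Reidemeister moves. A $3$-move (or $(-3)$-move) replaces two parallel arcs of a diagram by three positive (or negative) half twists; two diagrams are $3$-move equivalent if they are related by a finite sequence of $\pm3$-moves, their inverses and Reidemeister moves. Let $T_n$ be the trivial link of $n$ components. The core group $\Pi(D)$ of a diagram $D$ has the arcs of $D$ as generators and a relation $c=ab^{-1}a$ for each crossing, where $a$ is the overcrossing and $b,c$ are the undercrossings. Putting one arc $e$ equal to $1$ in $\Pi(D)$ gives (the core presentation of) the fundamental group $\Pi(D)/\langle\langle e\rangle\rangle$ of the double branched cover of the link. The third Burnside group $B_L(3)$ of the link $L$ of $D$ is the quotient of this group by all relations $a^3=1$; its unreduced version $\hat B_L(3)$ is the quotient of $\Pi(D)$ by all relations $a^3=1$. Let $B(4,3)$ be the quotient of the free group on $x,y,z,t$ by all cubes. Let $\hat\gamma$ (Chen's link) be the closure of the $5$-braid $(\sigma_1^{-1}\sigma_2\sigma_3\sigma_4^{-1}\sigma_3)^4$. Then: 1. $\hat\gamma$ is $3$-move equivalent to the closure of $\Delta_5^4=(\sigma_1\sigma_2\sigma_3\sigma_4)^{10}$.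 2. If two diagrams are $3$-move equivalent, then their groups $\hat B(3)$ are isomorphic, and so are their groups $B(3)$, whatever arcs are put equal to $1$. 3. The element $P=uwtu^{-1}w^{-1}t^{-1}$, where $u=xy^{-1}zt^{-1}$ and $w=x^{-1}yz^{-1}t$, is nontrivial in $B(4,3)$, and there is a surjective homomorphism $B(4,3)\to B_{\hat\gamma}(3)$ that sends $P$ to $1$. 4. For every $n\ge 0$, $\hat B_{\hat\gamma}(3)\not\cong \hat B_{T_n}(3)$, and (for $n\ge1$) $B_{\hat\gamma}(3)\not\cong B_{T_n}(3)$. 5. For every $n$, $\hat\gamma$ is not $3$-move equivalent to $T_n$. In particular the Montesinos–Nakanishi conjecture, that every link is $3$-move equivalent to a trivial link, is false. -/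

import Mathlib

/-! Unoriented link diagrams are presented as sliced diagrams: a diagram in general position with
respect to the height function is cut by horizontal lines into elementary slices, each containing
exactly one maximum, minimum or crossing. Two sliced diagrams represent isotopic links if and only
if they are related by planar isotopies of sliced diagrams and Reidemeister moves. -/

namespace LinkDiag

/-- The non-trivial part of an elementary slice, read upwards: a minimum `∪`, a maximum `∩`, or a
crossing. In `crossing true` the strand going from lower left to upper right is the overcrossing;
in `crossing false` it is the strand going from lower right to upper left. -/
inductive Kind
  | cup
  | cap
  | crossing (s : Bool)
  deriving DecidableEq

/-- Number of endpoints at the bottom. -/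
def Kind.bottom : Kind → ℕ
  | .cup => 0
  | .cap => 2
  | .crossing _ => 2

/-- Number of endpoints at the top. -/
def Kind.top : Kind → ℕ
  | .cup => 2
  | .cap => 0
  | .crossing _ => 2

/-- An elementary slice: an elementary tangle with `pos` vertical strands to its left, and any
number of vertical strands to its right. Positions of strands are counted from `0`. -/
structure Slice where
  pos : ℕ
  kind : Kind
  deriving DecidableEq

def cup (i : ℕ) : Slice := ⟨i, .cup⟩
def cap (i : ℕ) : Slice := ⟨i, .cap⟩
def cross (i : ℕ) (s : Bool) : Slice := ⟨i, .crossing s⟩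

/-- The number of strands at the top of a stack of slices (the head of the list is the lowest
slice) placed on `n` strands; `none` if the slices do not fit. -/
def width : List Slice → ℕ → Option ℕ
  | [], n => some n
  | s :: w, n =>
      if s.pos + s.kind.bottom ≤ n then width w (n - s.kind.bottom + s.kind.top) else none

/-- A link diagram: a stack of slices without endpoints at the bottom and at the top. -/
structure LinkDiagram where
  word : List Slice
  closed : width word 0 = some 0

/-! ### Moves -/

/-- Planar isotopies of sliced diagrams and Reidemeister moves, as local replacements. -/
inductive IsotopyRule : List Slice → List Slice → Prop
  /-- An elementary tangle `A` and an elementary tangle `B` to the right of it, separated by `d`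
  vertical strands, may exchange their heights. -/
  | exchange (A B : Kind) (i d : ℕ) :
      IsotopyRule [⟨i + A.bottom + d, B⟩, ⟨i, A⟩] [⟨i, A⟩, ⟨i + A.top + d, B⟩]
  /-- Cancellation of a minimum and a neighbouring maximum. -/
  | zigzag_left (i : ℕ) : IsotopyRule [cup i, cap (i + 1)] []
  | zigzag_right (i : ℕ) : IsotopyRule [cup (i + 1), cap i] []
  /-- A crossing slides over a maximum, or under a minimum. -/
  | slide_cap (i : ℕ) (s : Bool) :
      IsotopyRule [cross i s, cap (i + 1)] [cross (i + 1) (!s), cap i]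
  | slide_cup (i : ℕ) (s : Bool) :
      IsotopyRule [cup (i + 1), cross i s] [cup i, cross (i + 1) (!s)]
  /-- First Reidemeister move: a kink, drawn at a maximum or at a minimum, is removed. -/
  | reidemeister_one_cap (i : ℕ) (s : Bool) : IsotopyRule [cross i s, cap i] [cap i]
  | reidemeister_one_cup (i : ℕ) (s : Bool) : IsotopyRule [cup i, cross i s] [cup i]
  /-- Second Reidemeister move. -/
  | reidemeister_two (i : ℕ) (s : Bool) : IsotopyRule [cross i s, cross i (!s)] []
  /-- Third Reidemeister move; the condition says that the three strands lie at three different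
  heights. -/
  | reidemeister_three (i : ℕ) (s₁ s₂ s₃ : Bool) (h : s₂ = s₁ ∨ s₂ = s₃) :
      IsotopyRule [cross i s₁, cross (i + 1) s₂, cross i s₃]
        [cross (i + 1) s₃, cross i s₂, cross (i + 1) s₁]

/-- The local replacements generating `n`-move equivalence: isotopies, and the `n`-moves and
`(-n)`-moves, which insert `n` half twists into a pair of parallel strands. -/
inductive Rule (n : ℕ) : List Slice → List Slice → Prop
  | isotopy {l r : List Slice} (h : IsotopyRule l r) : Rule n l r
  | nMove (i : ℕ) (s : Bool) : Rule n (List.replicate n (cross i s)) []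

/-- `E` is obtained from `D` by one local replacement. -/
def Step (n : ℕ) (D E : LinkDiagram) : Prop :=
  ∃ u l r v : List Slice, Rule n l r ∧ D.word = u ++ l ++ v ∧ E.word = u ++ r ++ v

/-- `n`-move equivalence: the diagrams are related by a finite sequence of planar isotopies,
Reidemeister moves, `n`-moves, and inverses of these. -/
def MoveEquiv (n : ℕ) : LinkDiagram → LinkDiagram → Prop :=
  Relation.EqvGen (Step n)

/-! ### Trivial links and closed braids -/

theorem width_append (u v : List Slice) (n : ℕ) :
    width (u ++ v) n = (width u n).bind (width v) := by
  induction u generalizing n with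
  | nil => rfl
  | cons s u ih =>
    simp only [List.cons_append, width]
    split
    · exact ih _
    · rfl

/-- The trivial link diagram of `n` components: `n` circles without crossings. -/
def trivialLink (n : ℕ) : LinkDiagram where
  word := (List.replicate n [cup 0, cap 0]).flatten
  closed := by
    induction n with
    | zero => rfl
    | succ n ih =>
      rw [List.replicate_succ, List.flatten_cons, width_append]
      exact ih

/-- Braid words on `n` strands: `(i, true)` is the generator `σ_{i+1}` and `(i, false)` is its
inverse. -/
abbrev BraidWord (n : ℕ) := List (Fin (n - 1) × Bool)

def BraidWord.slices {n : ℕ} (b : BraidWord n) : List Slice :=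
  b.map fun x => cross x.1 x.2

/-- The `n` nested minima and maxima that close a braid on the first `n` of `2n` strands. -/
def closingCups (n : ℕ) : List Slice := (List.range n).map cup
def closingCaps (n : ℕ) : List Slice := (List.range n).reverse.map cap

theorem width_closingCups (n : ℕ) : width (closingCups n) 0 = some (2 * n) := by
  induction n with
  | zero => rfl
  | succ n ih =>
    rw [closingCups, List.range_succ, List.map_append, width_append]
    change (width (closingCups n) 0).bind _ = _
    rw [ih]
    simp [width, cup, Kind.bottom, Kind.top]
    omega

theorem width_closingCaps (n : ℕ) : width (closingCaps n) (2 * n) = some 0 := by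
  induction n with
  | zero => rfl
  | succ n ih =>
    rw [closingCaps, List.range_succ, List.reverse_append, List.map_append, width_append]
    have h : width (List.map cap [n].reverse) (2 * (n + 1)) = some (2 * n) := by
      simp [width, cap, Kind.bottom, Kind.top]
      omega
    rw [h]
    exact ih

theorem BraidWord.width_slices {n : ℕ} (b : BraidWord n) :
    width (BraidWord.slices b) (2 * n) = some (2 * n) := by
  induction b with
  | nil => rfl
  | cons x b ih =>
    have hx : (x.1 : ℕ) + 2 ≤ 2 * n := by have := x.1.isLt; omega
    have hn : 2 * n - 2 + 2 = 2 * n := by omega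
    have h : BraidWord.slices (n := n) (x :: b) = cross x.1 x.2 :: BraidWord.slices b := rfl
    rw [h]
    simpa [width, cross, Kind.bottom, Kind.top, hx, hn] using ih

/-- The closure of a braid. -/
def BraidWord.closure {n : ℕ} (b : BraidWord n) : LinkDiagram where
  word := closingCups n ++ b.slices ++ closingCaps n
  closed := by
    rw [width_append, width_append, width_closingCups, Option.bind_some, b.width_slices,
      Option.bind_some, width_closingCaps]

/-- The braid word `(σ₁⁻¹ σ₂ σ₃ σ₄⁻¹ σ₃)⁴`. -/
def chenBraid : BraidWord 5 :=
  (List.replicate 4 [(0, false), (1, true), (2, true), (3, false), (2, true)]).flatten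

/-- The braid word `Δ₅⁴ = (σ₁ σ₂ σ₃ σ₄)¹⁰`. -/
def deltaFourth : BraidWord 5 :=
  (List.replicate 10 [(0, true), (1, true), (2, true), (3, true)]).flatten

/-- Chen's link. -/
def chenLink : LinkDiagram := chenBraid.closure

/-! ### Burnside groups -/

/-- The quotient of `G` by all relations `a ^ n = 1`. -/
abbrev BurnsideQuotient (n : ℕ) (G : Type*) [Group G] : Type _ :=
  G ⧸ Subgroup.normalClosure (Set.range fun a : G => a ^ n)

/-- The Burnside group `B(r, n)`. -/
abbrev FreeBurnside (r n : ℕ) : Type := BurnsideQuotient n (FreeGroup (Fin r))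

/-- The standard generators of `B(r, n)`. -/
def FreeBurnside.gen (r n : ℕ) (i : Fin r) : FreeBurnside r n :=
  QuotientGroup.mk (FreeGroup.of i)

/-- The word `P = u w t u⁻¹ w⁻¹ t⁻¹` with `u = x y⁻¹ z t⁻¹` and `w = x⁻¹ y z⁻¹ t`. -/
def wordP {G : Type*} [Group G] (x y z t : G) : G :=
  let u := x * y⁻¹ * z * t⁻¹
  let w := x⁻¹ * y * z⁻¹ * t
  u * w * t * u⁻¹ * w⁻¹ * t⁻¹

/-- The element `P` of `B(4, 3) = {x, y, z, t : (a)³}`. -/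
def elementP : FreeBurnside 4 3 :=
  wordP (FreeBurnside.gen 4 3 0) (FreeBurnside.gen 4 3 1) (FreeBurnside.gen 4 3 2)
    (FreeBurnside.gen 4 3 3)

/-- The intersection points of a diagram with the horizontal lines between its slices. Each one
names the arc (from undercrossing to undercrossing) of the diagram on which it lies. -/
structure Strand (D : LinkDiagram) where
  level : ℕ
  pos : ℕ
  valid : ∃ n, width (D.word.take level) 0 = some n ∧ pos < n

/-- `Through s i j`: in the slice `s` the bottom endpoint number `i` and the top endpoint number
`j` lie on the same arc. -/
inductive Through : Slice → ℕ → ℕ → Prop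
  | left (s : Slice) (i : ℕ) (h : i < s.pos) : Through s i i
  | right (s : Slice) (d : ℕ) : Through s (s.pos + s.kind.bottom + d) (s.pos + s.kind.top + d)
  | over_true (i : ℕ) : Through (cross i true) i (i + 1)
  | over_false (i : ℕ) : Through (cross i false) (i + 1) i

open FreeGroup in
/-- The relators of the core group: strands on the same arc are identified, and each crossing
gives the relation `c = a b⁻¹ a`, where `a` is the overcrossing and `b`, `c` are the
undercrossings. -/
inductive CoreRelator (D : LinkDiagram) : FreeGroup (Strand D) → Prop
  | through (s : Slice) (p q : Strand D) (hs : D.word[p.level]? = some s)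
      (hq : q.level = p.level + 1) (h : Through s p.pos q.pos) :
      CoreRelator D (of p * (of q)⁻¹)
  | cup (i : ℕ) (p q : Strand D) (k : ℕ) (hs : D.word[k]? = some (LinkDiag.cup i))
      (hp : p.level = k + 1 ∧ p.pos = i) (hq : q.level = k + 1 ∧ q.pos = i + 1) :
      CoreRelator D (of p * (of q)⁻¹)
  | cap (i : ℕ) (p q : Strand D) (k : ℕ) (hs : D.word[k]? = some (LinkDiag.cap i))
      (hp : p.level = k ∧ p.pos = i) (hq : q.level = k ∧ q.pos = i + 1) :
      CoreRelator D (of p * (of q)⁻¹)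
  | crossing_true (i : ℕ) (a b c : Strand D) (k : ℕ) (hs : D.word[k]? = some (cross i true))
      (ha : a.level = k ∧ a.pos = i) (hb : b.level = k ∧ b.pos = i + 1)
      (hc : c.level = k + 1 ∧ c.pos = i) :
      CoreRelator D (of c * (of a * (of b)⁻¹ * of a)⁻¹)
  | crossing_false (i : ℕ) (a b c : Strand D) (k : ℕ) (hs : D.word[k]? = some (cross i false))
      (ha : a.level = k ∧ a.pos = i + 1) (hb : b.level = k ∧ b.pos = i)
      (hc : c.level = k + 1 ∧ c.pos = i + 1) :
      CoreRelator D (of c * (of a * (of b)⁻¹ * of a)⁻¹)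

/-- The core group of a diagram: arcs are generators, and each crossing gives a relation
`c = a b⁻¹ a`. -/
abbrev CoreGroup (D : LinkDiagram) : Type := PresentedGroup {r | CoreRelator D r}

/-- The class of an arc in the core group. -/
def arc {D : LinkDiagram} (e : Strand D) : CoreGroup D := PresentedGroup.of e

/-- The core presentation of the fundamental group of the double branched cover `M_D^(2)` of the
link: the core group with one arc `e` put equal to `1`. -/
abbrev DoubleCoverGroup (D : LinkDiagram) (e : Strand D) : Type :=
  CoreGroup D ⧸ Subgroup.normalClosure {arc e}

/-- The `n`th Burnside group, unreduced version: the core group modulo `n`th powers. -/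
abbrev CoreBurnside (n : ℕ) (D : LinkDiagram) : Type := BurnsideQuotient n (CoreGroup D)

/-- The `n`th Burnside group of a link: the fundamental group of the double branched cover modulo
`n`th powers. -/
abbrev LinkBurnside (n : ℕ) (D : LinkDiagram) (e : Strand D) : Type :=
  BurnsideQuotient n (DoubleCoverGroup D e)

end LinkDiag

/-! A coloring of a diagram by a group `H` satisfies `c = a b⁻¹ a` at each crossing; if `h ^ 3 = 1`
in `H`, then three half twists do not change the colors of two strands, so that the colorings can
be carried through 3-moves. The unreduced Burnside group represents the colorings, hence it is
invariant by Yoneda's lemma; translating a coloring so that a given arc has color `1` relates it to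
the reduced group.

Modulo the cubes of the standard generators `a, b, c, d` of the braid group on five strands,
`ζ = (a b) ^ 3` is an involution, and `c`, `d`, `k = ζ c ζ⁻¹` satisfy the braid relations of
`a`, `b`, `c`. Conjugated by `b c`, Chen's braid is the fourth power of `β = b a⁻¹ b c d⁻¹`, and
both `β ^ 4` and `Δ₅ ^ 4` are equal to `a (c d k) ^ 4`.

A coloring of the closure of `Δ₅ ^ 4` whose last strand has color `1` sends `P` to `1`, whereas `P`
is nontrivial in a group of affine maps of the exterior algebra of `𝔽₃²`. The trivial link of `n`
components has `|H| ^ n` colorings. Chen's link has `3 ^ 5` colorings by `ℤ/3`, which forces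
`n = 5`, but fewer than `|H| ^ 5` colorings by the group `H` in which `P` is nontrivial. -/

namespace LinkDiag

/-! ### Braid relations between elements of order three -/

section CubicBraids

variable {G : Type*} [Group G] {a b c d : G}

theorem mul_self_eq_inv (ha : a ^ 3 = 1) : a * a = a⁻¹ :=
  eq_inv_of_mul_eq_one_left (by rw [← pow_two, ← pow_succ, ha])

/-- The braid relation between neighbouring generators of a braid group. -/
def BraidRel (a b : G) : Prop := a * b * a = b * a * b

/-- The conjugate of `c` by the full twist of `a` and `b`. Modulo cubes it commutes with `a` and
`c`, and for a fourth generator `d` the triple `c, d, twistConj a b c` satisfies the same relations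
as `a, b, c`. -/
def twistConj (a b c : G) : G := (a * b) ^ 3 * c * ((a * b) ^ 3)⁻¹

namespace BraidRel

protected theorem eq (h : BraidRel a b) : a * b * a = b * a * b := h

theorem symm (h : BraidRel a b) : BraidRel b a := h.eq.symm

theorem semiconjBy (h : BraidRel a b) : SemiconjBy (a * b) a b := by
  rw [SemiconjBy, h.eq, mul_assoc]

theorem conj (h : BraidRel a b) (g : G) : BraidRel (g * a * g⁻¹) (g * b * g⁻¹) := by
  simpa only [BraidRel, conj_mul] using congrArg (g * · * g⁻¹) h.eq

theorem pow_eq_one {n : ℕ} (h : BraidRel a b) (ha : a ^ n = 1) : b ^ n = 1 :=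
  (h.semiconjBy.pow_right n).eq_one_iff.1 ha

theorem mul_pow_three (h : BraidRel a b) : (a * b) ^ 3 = (a * b * a) ^ 2 := by
  calc (a * b) ^ 3 = a * b * a * (b * a * b) := by
        simp only [pow_succ, pow_zero, one_mul, mul_assoc]
    _ = (a * b * a) ^ 2 := by rw [← h.eq, pow_two]

theorem mul_pow_three_comm (h : BraidRel a b) : (b * a) ^ 3 = (a * b) ^ 3 := by
  rw [h.mul_pow_three, h.symm.mul_pow_three, h.eq]

theorem commute_mul_pow_three (h : BraidRel a b) : Commute ((a * b) ^ 3) a := by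
  have swap : SemiconjBy (a * b * a) b a := by
    nth_rw 1 [SemiconjBy, mul_assoc (a * b), mul_assoc a b, ← mul_assoc b a, ← h.eq]
  have swap' : SemiconjBy (a * b * a) a b := h.semiconjBy.mul_left (Commute.refl a)
  rw [h.mul_pow_three, pow_two]
  exact swap.mul_left swap'

theorem mul_inv_pow_two (h : BraidRel a b) (ha : a ^ 3 = 1) : (b * a⁻¹) ^ 2 = (a * b) ^ 3 := by
  calc (b * a⁻¹) ^ 2 = b * a * (a * b * a) * a := by
        simp [← mul_self_eq_inv ha, pow_succ, mul_assoc]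
    _ = (b * a) ^ 3 := by rw [h.eq]; simp [pow_succ, mul_assoc]
    _ = (a * b) ^ 3 := h.mul_pow_three_comm

theorem mul_pow_three_mul_self (h : BraidRel a b) (ha : a ^ 3 = 1) :
    (a * b) ^ 3 * (a * b) ^ 3 = 1 := by
  calc (a * b) ^ 3 * (a * b) ^ 3 = (b * a⁻¹) ^ 2 * (a * b⁻¹) ^ 2 := by
        rw [h.mul_inv_pow_two ha, h.symm.mul_inv_pow_two (h.pow_eq_one ha), h.mul_pow_three_comm]
    _ = 1 := by simp [pow_succ, mul_assoc]

theorem mul_inv_mul (h : BraidRel a b) (ha : a ^ 3 = 1) : b * a⁻¹ * b = (a * b) ^ 3 * a := by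
  rw [← h.mul_inv_pow_two ha]
  simp [pow_succ, mul_assoc]

theorem semiconjBy_twistConj (h : BraidRel a b) (ha : a ^ 3 = 1) :
    SemiconjBy ((a * b) ^ 3) (twistConj a b c) c := by
  rw [← SemiconjBy.inv_symm_left_iff, inv_eq_of_mul_eq_one_left (h.mul_pow_three_mul_self ha)]
  exact SemiconjBy.conj_mk ..

end BraidRel

theorem pow_succ_mul_eq {x y p q : G} {n : ℕ} (h : x ^ n * p = (x * y) ^ n)
    (hq : SemiconjBy (x * y) q p) : x ^ (n + 1) * (y * q) = (x * y) ^ (n + 1) := by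
  calc x ^ (n + 1) * (y * q) = x ^ n * (x * y * q) := by simp only [pow_succ, mul_assoc]
    _ = (x * y) ^ (n + 1) := by rw [hq.eq, ← mul_assoc, h, pow_succ]

/-- The relations between three consecutive generators of a braid group. -/
structure BraidTriple (a b c : G) : Prop where
  left : BraidRel a b
  right : BraidRel b c
  comm : Commute a c

namespace BraidTriple

theorem semiconjBy_left (h : BraidTriple a b c) : SemiconjBy (a * b * c) a b :=
  h.left.semiconjBy.mul_left h.comm.symm

theorem semiconjBy_right (h : BraidTriple a b c) : SemiconjBy (a * b * c) b c := by
  rw [mul_assoc]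
  exact SemiconjBy.mul_left h.comm h.right.semiconjBy

theorem semiconjBy_pow_two (h : BraidTriple a b c) : SemiconjBy ((a * b * c) ^ 2) c a := by
  rw [← SemiconjBy.inv_right_iff, SemiconjBy]
  calc (a * b * c) ^ 2 * c⁻¹ = a * b * c * (a * b) := by simp [pow_succ, mul_assoc]
    _ = b * c * (a * b * c) := (h.semiconjBy_left.mul_right h.semiconjBy_right).eq
    _ = a⁻¹ * (a * b * c) ^ 2 := by simp [pow_succ, mul_assoc]

theorem commute_pow_four_right (h : BraidTriple a b c) : Commute ((a * b * c) ^ 4) c := by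
  rw [show 4 = 2 + 2 from rfl, pow_add]; nth_rw 1 [pow_two]
  exact (h.semiconjBy_right.mul_left h.semiconjBy_left).mul_left h.semiconjBy_pow_two

theorem pow_four_eq (h : BraidTriple a b c) :
    (a * b * c) ^ 4 = (a * b) ^ 3 * (c * (b * a)) * (a * b * c) := by
  have square : (a * b) ^ 2 * (c * b) = (a * b * c) ^ 2 :=
    pow_succ_mul_eq (by simp only [pow_one]) h.semiconjBy_right
  have cube := pow_succ_mul_eq square (h.semiconjBy_right.mul_right h.semiconjBy_left)
  rw [cube, ← pow_succ]

theorem pow_four_eq_twistConj (h : BraidTriple a b c) (ha : a ^ 3 = 1) :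
    (a * b * c) ^ 4 = twistConj a b c * a * c := by
  calc (a * b * c) ^ 4 = (a * b) ^ 3 * c * (b * (a * a) * b) * c := by
        rw [h.pow_four_eq]; simp only [mul_assoc]
    _ = twistConj a b c * a * c := by
      rw [mul_self_eq_inv ha, h.left.mul_inv_mul ha, twistConj,
        inv_eq_of_mul_eq_one_left (h.left.mul_pow_three_mul_self ha)]
      simp only [mul_assoc]

theorem commute_twistConj_left (h : BraidTriple a b c) : Commute (twistConj a b c) a :=
  (h.left.commute_mul_pow_three.mul_left h.comm.symm).mul_left
    h.left.commute_mul_pow_three.inv_left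

theorem commute_twistConj_right (h : BraidTriple a b c) (ha : a ^ 3 = 1) :
    Commute (twistConj a b c) c := by
  rw [show twistConj a b c = (a * b * c) ^ 4 * (a * c)⁻¹ by
    rw [h.pow_four_eq_twistConj ha, mul_assoc _ a, mul_inv_cancel_right]]
  exact h.commute_pow_four_right.mul_left (h.comm.mul_left (Commute.refl c)).inv_left

end BraidTriple

/-- The relations between four consecutive generators of a braid group. -/
structure BraidQuadruple (a b c d : G) : Prop extends BraidTriple a b c where
  last : BraidRel c d
  comm_first_last : Commute a d
  comm_second_last : Commute b d

namespace BraidQuadruple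

theorem semiconjBy_first (h : BraidQuadruple a b c d) : SemiconjBy (a * b * c * d) a b :=
  h.semiconjBy_left.mul_left h.comm_first_last.symm

theorem semiconjBy_second (h : BraidQuadruple a b c d) : SemiconjBy (a * b * c * d) b c :=
  h.semiconjBy_right.mul_left h.comm_second_last.symm

theorem semiconjBy_third (h : BraidQuadruple a b c d) : SemiconjBy (a * b * c * d) c d := by
  rw [mul_assoc]
  exact SemiconjBy.mul_left (h.comm_first_last.mul_left h.comm_second_last) h.last.semiconjBy

theorem semiconjBy_pow_two (h : BraidQuadruple a b c d) :
    SemiconjBy ((a * b * c * d) ^ 2) d a := by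
  rw [← SemiconjBy.inv_right_iff, SemiconjBy]
  calc (a * b * c * d) ^ 2 * d⁻¹ = a * b * c * d * (a * b * c) := by simp [pow_succ, mul_assoc]
    _ = b * c * d * (a * b * c * d) :=
      ((h.semiconjBy_first.mul_right h.semiconjBy_second).mul_right h.semiconjBy_third).eq
    _ = a⁻¹ * (a * b * c * d) ^ 2 := by simp [pow_succ, mul_assoc]

theorem commute_pow_five_second (h : BraidQuadruple a b c d) :
    Commute ((a * b * c * d) ^ 5) b := by
  have round := ((h.semiconjBy_first.mul_left h.semiconjBy_pow_two).mul_left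
    h.semiconjBy_third).mul_left h.semiconjBy_second
  rwa [← pow_succ', ← pow_succ, ← pow_succ] at round

theorem commute_pow_five_third (h : BraidQuadruple a b c d) :
    Commute ((a * b * c * d) ^ 5) c := by
  have round := ((h.semiconjBy_second.mul_left h.semiconjBy_first).mul_left
    h.semiconjBy_pow_two).mul_left h.semiconjBy_third
  rwa [← pow_two, ← pow_add, ← pow_succ] at round

theorem pow_five_eq (h : BraidQuadruple a b c d) :
    (a * b * c * d) ^ 5 = (a * b * c) ^ 4 * (d * (c * (b * a))) * (a * b * c * d) := by
  have square : (a * b * c) ^ 2 * (d * c) = (a * b * c * d) ^ 2 :=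
    pow_succ_mul_eq (by simp only [pow_one]) h.semiconjBy_third
  have cube := pow_succ_mul_eq square (h.semiconjBy_third.mul_right h.semiconjBy_second)
  have fourth := pow_succ_mul_eq cube
    (h.semiconjBy_third.mul_right (h.semiconjBy_second.mul_right h.semiconjBy_first))
  rw [fourth, ← pow_succ]

theorem commute_twist_last (h : BraidQuadruple a b c d) : Commute ((a * b) ^ 3) d :=
  (h.comm_first_last.mul_left h.comm_second_last).pow_left 3

theorem braidTriple_twistConj (h : BraidQuadruple a b c d) (ha : a ^ 3 = 1) :
    BraidTriple c d (twistConj a b c) := by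
  refine ⟨h.last, ?_, (h.commute_twistConj_right ha).symm⟩
  have := h.last.symm.conj ((a * b) ^ 3)
  rwa [h.commute_twist_last.eq, mul_inv_cancel_right] at this

theorem commute_twist_mul (h : BraidQuadruple a b c d) (ha : a ^ 3 = 1) :
    Commute ((a * b) ^ 3) (twistConj a b c * c * d) := by
  have swap : SemiconjBy ((a * b) ^ 3) (twistConj a b c * c) (c * twistConj a b c) :=
    (h.left.semiconjBy_twistConj ha).mul_right (SemiconjBy.conj_mk ..)
  rw [← (h.commute_twistConj_right ha).eq] at swap
  exact swap.mul_right h.commute_twist_last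

theorem pow_five_eq_twistConj (h : BraidQuadruple a b c d) (ha : a ^ 3 = 1) :
    (a * b * c * d) ^ 5 = a⁻¹ * ((twistConj a b c * c * d) ^ 2 * (a * b) ^ 3) := by
  have commute_a : Commute a (twistConj a b c * c * d * (c * (a * b) ^ 3)) :=
    ((h.commute_twistConj_left.symm.mul_right h.comm).mul_right h.comm_first_last).mul_right
      (h.comm.mul_right h.left.commute_mul_pow_three.symm)
  calc (a * b * c * d) ^ 5
      = twistConj a b c * a * c * d * c * (b * (a * a) * b) * c * d := by
        rw [h.pow_five_eq, h.pow_four_eq_twistConj ha]; simp only [mul_assoc]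
    _ = twistConj a b c * a * c * d * c * (a * b) ^ 3 * a * (c * d) := by
      rw [mul_self_eq_inv ha, h.left.mul_inv_mul ha]; simp only [mul_assoc]
    _ = a * (twistConj a b c * c * d * (c * (a * b) ^ 3) * a) * (c * d) := by
      rw [h.commute_twistConj_left.eq]; simp only [mul_assoc]
    _ = a * a * (twistConj a b c * c * d * ((a * b) ^ 3 * (twistConj a b c * c * d))) := by
      rw [← commute_a.eq, ← (h.left.semiconjBy_twistConj ha).eq]; simp only [mul_assoc]
    _ = a⁻¹ * ((twistConj a b c * c * d) ^ 2 * (a * b) ^ 3) := by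
      rw [mul_self_eq_inv ha, (h.commute_twist_mul ha).eq, pow_two,
        mul_assoc (twistConj a b c * c * d)]

theorem pow_ten_eq (h : BraidQuadruple a b c d) (ha : a ^ 3 = 1) :
    (a * b * c * d) ^ 10 = a * (c * d * twistConj a b c) ^ 4 := by
  have rotate : (twistConj a b c * c * d) ^ 4 = (c * d * twistConj a b c) ^ 4 := by
    have conj : SemiconjBy (twistConj a b c) (c * d * twistConj a b c)
        (twistConj a b c * c * d) := by
      simp only [SemiconjBy, mul_assoc]
    exact mul_right_cancel ((conj.pow_right 4).eq.symm.trans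
      (h.braidTriple_twistConj ha).commute_pow_four_right.eq.symm)
  have commute_a : Commute a⁻¹ ((twistConj a b c * c * d) ^ 2 * (a * b) ^ 3) :=
    ((((h.commute_twistConj_left.symm.mul_right h.comm).mul_right h.comm_first_last).pow_right
      2).mul_right h.left.commute_mul_pow_three.symm).inv_left
  have commute_sq : Commute ((twistConj a b c * c * d) ^ 2) ((a * b) ^ 3) :=
    ((h.commute_twist_mul ha).pow_right 2).symm
  calc (a * b * c * d) ^ 10 = ((a * b * c * d) ^ 5) ^ 2 := by rw [← pow_mul]
    _ = (a * a)⁻¹ * ((twistConj a b c * c * d) ^ 4 * ((a * b) ^ 3) ^ 2) := by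
      rw [h.pow_five_eq_twistConj ha, commute_a.mul_pow, commute_sq.mul_pow, pow_two a⁻¹,
        ← mul_inv_rev, ← pow_mul _ 2 2]
    _ = a * (c * d * twistConj a b c) ^ 4 := by
      rw [mul_self_eq_inv ha, inv_inv, rotate, pow_two, h.left.mul_pow_three_mul_self ha, mul_one]

theorem mul_inv_mul_pow_two_eq (h : BraidQuadruple a b c d) (ha : a ^ 3 = 1) :
    (b * a⁻¹ * b * c * d⁻¹) ^ 2 = a⁻¹ * (twistConj a b c * c⁻¹ * (c * d) ^ 3) := by
  have hd : d ^ 3 = 1 := h.last.pow_eq_one (h.right.pow_eq_one (h.left.pow_eq_one ha))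
  have commute_a_twist := h.left.commute_mul_pow_three.symm
  have commute_a : Commute a ((a * b) ^ 3 * c * d⁻¹) :=
    (commute_a_twist.mul_right h.comm).mul_right h.comm_first_last.inv_right
  calc (b * a⁻¹ * b * c * d⁻¹) ^ 2 = (a * ((a * b) ^ 3 * c * d⁻¹)) ^ 2 := by
        rw [h.left.mul_inv_mul ha, ← commute_a_twist.eq]; simp only [mul_assoc]
    _ = a * a * ((a * b) ^ 3 * c * (d⁻¹ * (a * b) ^ 3) * c * d⁻¹) := by
      rw [commute_a.mul_pow, pow_two, pow_two]; simp only [mul_assoc]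
    _ = a⁻¹ * ((a * b) ^ 3 * c * (a * b) ^ 3 * c⁻¹ * (c * d⁻¹) ^ 2) := by
      rw [mul_self_eq_inv ha, ← h.commute_twist_last.inv_right.eq]
      simp only [pow_two, mul_assoc, inv_mul_cancel_left]
    _ = a⁻¹ * (twistConj a b c * c⁻¹ * (c * d) ^ 3) := by
      rw [h.last.symm.mul_inv_pow_two hd, h.last.mul_pow_three_comm, twistConj,
        inv_eq_of_mul_eq_one_left (h.left.mul_pow_three_mul_self ha)]

theorem mul_inv_mul_pow_four_eq (h : BraidQuadruple a b c d) (ha : a ^ 3 = 1) :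
    (b * a⁻¹ * b * c * d⁻¹) ^ 4 = a * (c * d * twistConj a b c) ^ 4 := by
  have hc : c ^ 3 = 1 := h.right.pow_eq_one (h.left.pow_eq_one ha)
  have triple := h.braidTriple_twistConj ha
  have commute_a : Commute a⁻¹ (twistConj a b c * c⁻¹ * (c * d) ^ 3) :=
    ((h.commute_twistConj_left.symm.mul_right h.comm.inv_right).mul_right
      ((h.comm.mul_right h.comm_first_last).pow_right 3)).inv_left
  rw [show 4 = 2 * 2 from rfl, pow_mul, h.mul_inv_mul_pow_two_eq ha, commute_a.mul_pow,
    pow_two a⁻¹, ← mul_inv_rev, mul_self_eq_inv ha, inv_inv]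
  congr 1
  have commute_c_m := triple.commute_twistConj_left.symm
  have commute_m_k := triple.commute_twistConj_right hc
  have commute_c_k := triple.comm
  have hm : twistConj c d (twistConj a b c) = (c * d) ^ 3 * twistConj a b c * (c * d) ^ 3 := by
    rw [twistConj, inv_eq_of_mul_eq_one_left (h.last.mul_pow_three_mul_self hc)]
  generalize twistConj a b c = k at *
  calc (k * c⁻¹ * (c * d) ^ 3) ^ 2 = k * c⁻¹ * ((c * d) ^ 3 * k * (c⁻¹ * (c * d) ^ 3)) := by
        simp only [pow_two, mul_assoc]
    _ = k * c⁻¹ * (twistConj c d k * c⁻¹) := by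
      rw [← h.last.commute_mul_pow_three.inv_right.eq, hm]; simp only [mul_assoc]
    _ = k * ((c * c)⁻¹ * twistConj c d k) := by
      rw [← commute_c_m.inv_left.eq]; simp only [mul_inv_rev, mul_assoc]
    _ = twistConj c d k * c * k := by
      rw [mul_self_eq_inv hc, inv_inv, commute_c_m.eq, ← mul_assoc, ← commute_m_k.eq, mul_assoc,
        mul_assoc, commute_c_k.eq]
    _ = (c * d * k) ^ 4 := by rw [triple.pow_four_eq_twistConj hc]

theorem chenBraid_pow_four (h : BraidQuadruple a b c d) (ha : a ^ 3 = 1) :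
    (a⁻¹ * b * c * d⁻¹ * c) ^ 4 = (a * b * c * d) ^ 10 := by
  have conj : SemiconjBy (b * c) (a⁻¹ * b * c * d⁻¹ * c) (b * a⁻¹ * b * c * d⁻¹) := by
    calc b * c * (a⁻¹ * b * c * d⁻¹ * c) = b * (c * a⁻¹) * b * c * d⁻¹ * c := by
          simp only [mul_assoc]
      _ = b * a⁻¹ * (c * b * c) * d⁻¹ * c := by
        rw [← h.comm.inv_left.eq]; simp only [mul_assoc]
      _ = b * a⁻¹ * b * c * (b * d⁻¹) * c := by rw [← h.right.eq]; simp only [mul_assoc]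
      _ = b * a⁻¹ * b * c * d⁻¹ * (b * c) := by
        rw [h.comm_second_last.inv_right.eq]; simp only [mul_assoc]
  have commute_pow_ten : Commute ((a * b * c * d) ^ 10) (b * c) := by
    rw [show 10 = 5 * 2 from rfl, pow_mul]
    exact (h.commute_pow_five_second.mul_right h.commute_pow_five_third).pow_left 2
  apply mul_left_cancel (a := b * c)
  rw [(conj.pow_right 4).eq, h.mul_inv_mul_pow_four_eq ha, ← h.pow_ten_eq ha, commute_pow_ten.eq]

end BraidQuadruple

end CubicBraids

/-! ### Moves of closed braids -/

section ClosedBraids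

variable {N m : ℕ}

theorem BraidWord.slices_append (u v : BraidWord N) :
    BraidWord.slices (n := N) (u ++ v) = BraidWord.slices u ++ BraidWord.slices v :=
  List.map_append

theorem Rule.step_closure {w w' : BraidWord N} (h : Rule m w.slices w'.slices)
    (u v : BraidWord N) :
    Step m (BraidWord.closure (u ++ w ++ v)) (BraidWord.closure (u ++ w' ++ v)) :=
  ⟨closingCups N ++ BraidWord.slices u, _, _, BraidWord.slices v ++ closingCaps N, h,
    by simp only [BraidWord.closure, BraidWord.slices_append, List.append_assoc],
    by simp only [BraidWord.closure, BraidWord.slices_append, List.append_assoc]⟩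

/-- The congruence on braid words that identifies two words if they are interchangeable in closed
braids up to `m`-moves. -/
def closureCon (N m : ℕ) : Con (FreeMonoid (Fin (N - 1) × Bool)) where
  r w w' := ∀ u v : BraidWord N, MoveEquiv m (BraidWord.closure (u ++ w.toList ++ v))
    (BraidWord.closure (u ++ w'.toList ++ v))
  iseqv := ⟨fun _ _ _ => .refl _, fun h u v => .symm _ _ (h u v),
    fun h h' u v => .trans _ _ _ (h u v) (h' u v)⟩
  mul' := fun {w x y z} hwx hyz u v => by
    have hleft := hwx u (y.toList ++ v)
    have hright := hyz (u ++ x.toList) v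
    simp only [FreeMonoid.toList_mul, List.append_assoc] at hleft hright ⊢
    exact .trans _ _ _ hleft hright

/-- The class of a letter modulo `closureCon`. -/
def closureLetter (N m : ℕ) (x : Fin (N - 1) × Bool) : (closureCon N m).Quotient :=
  (closureCon N m).mk' (FreeMonoid.of x)

theorem closureCon_mk_ofList (w : BraidWord N) :
    (closureCon N m).mk' (FreeMonoid.ofList w) = (w.map (closureLetter N m)).prod := by
  induction w with
  | nil => exact map_one _
  | cons x w ih => rw [FreeMonoid.ofList_cons, map_mul, ih, List.map_cons, List.prod_cons]; rfl

theorem moveEquiv_closure {w w' : BraidWord N}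
    (h : (w.map (closureLetter N m)).prod = (w'.map (closureLetter N m)).prod) :
    MoveEquiv m (BraidWord.closure w) (BraidWord.closure w') := by
  rw [← closureCon_mk_ofList, ← closureCon_mk_ofList] at h
  simpa only [FreeMonoid.toList_ofList, List.nil_append, List.append_nil] using
    (Con.eq _).1 h [] []

theorem Rule.prod_closureLetter_eq {w w' : BraidWord N} (h : Rule m w.slices w'.slices) :
    (w.map (closureLetter N m)).prod = (w'.map (closureLetter N m)).prod := by
  rw [← closureCon_mk_ofList, ← closureCon_mk_ofList]
  exact (Con.eq _).2 fun u v => .rel _ _ (h.step_closure u v)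

theorem closureLetter_mul_not (i : Fin (N - 1)) (s : Bool) :
    closureLetter N m (i, s) * closureLetter N m (i, !s) = 1 := by
  have h : Rule m (BraidWord.slices (n := N) [(i, s), (i, !s)])
      (BraidWord.slices (n := N) []) := .isotopy (.reidemeister_two i s)
  simpa only [List.map_cons, List.map_nil, List.prod_cons, List.prod_nil, mul_one] using
    h.prod_closureLetter_eq

/-- The invertible class of the braid generator `σ_{i+1}` modulo `closureCon`. -/
def closureSigma (N m : ℕ) (i : Fin (N - 1)) : ((closureCon N m).Quotient)ˣ where
  val := closureLetter N m (i, true)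
  inv := closureLetter N m (i, false)
  val_inv := closureLetter_mul_not i true
  inv_val := closureLetter_mul_not i false

theorem closureSigma_pow (i : Fin (N - 1)) : closureSigma N m i ^ m = 1 := by
  have h : Rule m (BraidWord.slices (n := N) (List.replicate m (i, true)))
      (BraidWord.slices (n := N) []) := by
    simpa only [BraidWord.slices, List.map_replicate, List.map_nil] using
      Rule.nMove (n := m) i true
  have hprod := h.prod_closureLetter_eq
  rw [List.map_replicate, List.prod_replicate, List.map_nil, List.prod_nil] at hprod
  exact Units.ext hprod

theorem braidRel_closureSigma {i j : Fin (N - 1)} (hij : (j : ℕ) = i + 1) :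
    BraidRel (closureSigma N m i) (closureSigma N m j) := by
  have h : Rule m (BraidWord.slices (n := N) [(i, true), (j, true), (i, true)])
      (BraidWord.slices (n := N) [(j, true), (i, true), (j, true)]) := by
    simpa only [BraidWord.slices, List.map_cons, List.map_nil, hij] using
      Rule.isotopy (.reidemeister_three i true true true (.inl rfl))
  have hprod := h.prod_closureLetter_eq
  simp only [List.map_cons, List.map_nil, List.prod_cons, List.prod_nil, mul_one,
    ← mul_assoc] at hprod
  exact Units.ext hprod

theorem commute_closureSigma {i j : Fin (N - 1)} (hij : (i : ℕ) + 2 ≤ j) :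
    Commute (closureSigma N m i) (closureSigma N m j) := by
  obtain ⟨d, hd⟩ := Nat.exists_eq_add_of_le hij
  have h : Rule m (BraidWord.slices (n := N) [(j, true), (i, true)])
      (BraidWord.slices (n := N) [(i, true), (j, true)]) := by
    simp only [BraidWord.slices, List.map_cons, List.map_nil, hd]
    exact .isotopy (.exchange (.crossing true) (.crossing true) i d)
  have hprod := h.prod_closureLetter_eq
  simp only [List.map_cons, List.map_nil, List.prod_cons, List.prod_nil, mul_one] at hprod
  exact Units.ext hprod.symm

theorem braidQuadruple_closureSigma (m : ℕ) :
    BraidQuadruple (closureSigma 5 m 0) (closureSigma 5 m 1) (closureSigma 5 m 2)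
      (closureSigma 5 m 3) where
  left := braidRel_closureSigma rfl
  right := braidRel_closureSigma rfl
  comm := commute_closureSigma (by decide)
  last := braidRel_closureSigma rfl
  comm_first_last := commute_closureSigma (by decide)
  comm_second_last := commute_closureSigma (by decide)

theorem prod_map_flatten_replicate {α M : Type*} [Monoid M] (f : α → M) (k : ℕ) (w : List α) :
    ((List.replicate k w).flatten.map f).prod = (w.map f).prod ^ k := by
  rw [List.map_flatten, List.map_replicate, List.prod_flatten, List.map_replicate,
    List.prod_replicate]

theorem moveEquiv_chenLink : MoveEquiv 3 chenLink deltaFourth.closure := by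
  apply moveEquiv_closure
  rw [chenBraid, deltaFourth, prod_map_flatten_replicate, prod_map_flatten_replicate]
  simp only [List.map_cons, List.map_nil, List.prod_cons, List.prod_nil, mul_one, ← mul_assoc]
  exact congrArg Units.val ((braidQuadruple_closureSigma 3).chenBraid_pow_four (closureSigma_pow 0))

end ClosedBraids

/-! ### A group of exponent three -/

/-- Pairs `(h, v)` with `v` in the exterior algebra of `𝔽₃²` and `h = 1 + α e₁ + β e₂ + γ e₁ e₂` a
unit of it acting by affine maps `w ↦ h w + v`. -/
@[ext]
structure ExteriorAffine where
  (α β γ v₀ v₁ v₂ v₃ : ZMod 3)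
  deriving DecidableEq

namespace ExteriorAffine

instance : Mul ExteriorAffine where
  mul p q := ⟨p.α + q.α, p.β + q.β, p.γ + q.γ + p.α * q.β - p.β * q.α, p.v₀ + q.v₀,
    p.v₁ + q.v₁ + p.α * q.v₀, p.v₂ + q.v₂ + p.β * q.v₀,
    p.v₃ + q.v₃ + p.γ * q.v₀ + p.α * q.v₂ - p.β * q.v₁⟩

instance : One ExteriorAffine := ⟨⟨0, 0, 0, 0, 0, 0, 0⟩⟩

theorem mul_def (p q : ExteriorAffine) :
    p * q = ⟨p.α + q.α, p.β + q.β, p.γ + q.γ + p.α * q.β - p.β * q.α, p.v₀ + q.v₀,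
      p.v₁ + q.v₁ + p.α * q.v₀, p.v₂ + q.v₂ + p.β * q.v₀,
      p.v₃ + q.v₃ + p.γ * q.v₀ + p.α * q.v₂ - p.β * q.v₁⟩ := rfl

theorem one_def : (1 : ExteriorAffine) = ⟨0, 0, 0, 0, 0, 0, 0⟩ := rfl

theorem mul_self_mul_self (p : ExteriorAffine) : p * p * p = 1 := by
  have three_eq_zero : (3 : ZMod 3) = 0 := rfl
  rw [mul_def, mul_def, one_def]
  ext
  · linear_combination p.α * three_eq_zero
  · linear_combination p.β * three_eq_zero
  · linear_combination p.γ * three_eq_zero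
  · linear_combination p.v₀ * three_eq_zero
  · linear_combination (p.v₁ + p.α * p.v₀) * three_eq_zero
  · linear_combination (p.v₂ + p.β * p.v₀) * three_eq_zero
  · linear_combination (p.v₃ + p.γ * p.v₀ + p.α * p.v₂ - p.β * p.v₁) * three_eq_zero

instance : Inv ExteriorAffine := ⟨fun p => p * p⟩

instance : Group ExteriorAffine :=
  Group.ofLeftAxioms
    (by intro p q r; simp only [mul_def]; ext <;> ring)
    (by intro p; rw [mul_def, one_def]; ext <;> ring)
    mul_self_mul_self

theorem pow_three_eq_one (p : ExteriorAffine) : p ^ 3 = 1 := by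
  rw [pow_succ, pow_two, mul_self_mul_self]

instance : Finite ExteriorAffine :=
  Finite.of_injective (fun p => (p.α, p.β, p.γ, p.v₀, p.v₁, p.v₂, p.v₃)) fun p q h => by
    cases p; cases q; simpa using h

/-- The translation `w ↦ w + 1`. -/
def translation : ExteriorAffine := ⟨0, 0, 0, 1, 0, 0, 0⟩

/-- The multiplication `w ↦ (1 + e₁) w`. -/
def mulOneAddE₁ : ExteriorAffine := ⟨1, 0, 0, 0, 0, 0, 0⟩

/-- The multiplication `w ↦ (1 + e₂) w`. -/
def mulOneAddE₂ : ExteriorAffine := ⟨0, 1, 0, 0, 0, 0, 0⟩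

theorem wordP_ne_one : wordP 1 translation mulOneAddE₁ mulOneAddE₂ ≠ 1 := by
  decide

end ExteriorAffine

/-! ### Homomorphisms from Burnside quotients -/

section BurnsideQuotient

variable {n : ℕ} {G H : Type*} [Group G] [Group H]

theorem BurnsideQuotient.pow_eq_one (x : BurnsideQuotient n G) : x ^ n = 1 := by
  induction x using QuotientGroup.induction_on with
  | H g =>
    rw [← QuotientGroup.mk_pow, QuotientGroup.eq_one_iff]
    exact Subgroup.subset_normalClosure ⟨g, rfl⟩

/-- The factorization of a homomorphism to a group of exponent `n` through the Burnside
quotient. -/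
def BurnsideQuotient.lift (hH : ∀ h : H, h ^ n = 1) (φ : G →* H) : BurnsideQuotient n G →* H :=
  QuotientGroup.lift _ φ <| show Subgroup.normalClosure (Set.range fun a : G => a ^ n) ≤ φ.ker by
    refine Subgroup.normalClosure_le_normal ?_
    rintro _ ⟨a, rfl⟩
    simp only [SetLike.mem_coe, MonoidHom.mem_ker, map_pow, hH]

@[simp]
theorem BurnsideQuotient.lift_mk (hH : ∀ h : H, h ^ n = 1) (φ : G →* H) (g : G) :
    BurnsideQuotient.lift hH φ (QuotientGroup.mk g) = φ g := rfl

theorem FreeBurnside.exists_hom {r : ℕ} (hH : ∀ h : H, h ^ n = 1) (f : Fin r → H) :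
    ∃ φ : FreeBurnside r n →* H, ∀ i, φ (FreeBurnside.gen r n i) = f i :=
  ⟨BurnsideQuotient.lift hH (FreeGroup.lift f), fun i => by
    rw [FreeBurnside.gen, BurnsideQuotient.lift_mk, FreeGroup.lift_apply_of]⟩

theorem map_wordP (φ : G →* H) (x y z t : G) :
    φ (wordP x y z t) = wordP (φ x) (φ y) (φ z) (φ t) := by
  simp [wordP]

theorem map_elementP {φ : FreeBurnside 4 3 →* H} {x y z t : H}
    (hφ : ∀ i, φ (FreeBurnside.gen 4 3 i) = ![x, y, z, t] i) : φ elementP = wordP x y z t := by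
  rw [elementP, map_wordP, hφ, hφ, hφ, hφ]
  rfl

end BurnsideQuotient

theorem elementP_ne_one : elementP ≠ 1 := by
  obtain ⟨φ, hφ⟩ := FreeBurnside.exists_hom ExteriorAffine.pow_three_eq_one
    ![1, .translation, .mulOneAddE₁, .mulOneAddE₂]
  intro h
  apply ExteriorAffine.wordP_ne_one
  rw [← map_elementP hφ, h, map_one]

/-! ### Colorings of stacks of slices -/

section Colorings

variable {G H : Type*} [Group G] [Group H]

/-- The core relation between the colors `u` at the bottom and `v` at the top of an elementary
tangle, both read from left to right. -/
inductive TangleRel : Kind → List H → List H → Prop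
  | cup (a : H) : TangleRel .cup [] [a, a]
  | cap (a : H) : TangleRel .cap [a, a] []
  | over_true (a b : H) : TangleRel (.crossing true) [a, b] [a * b⁻¹ * a, a]
  | over_false (a b : H) : TangleRel (.crossing false) [b, a] [a, a * b⁻¹ * a]

/-- The core relation between the colors `x` at the bottom and `y` at the top of an elementary
slice. -/
def SliceRel (s : Slice) (x y : List H) : Prop :=
  ∃ p u v q, p.length = s.pos ∧ TangleRel s.kind u v ∧ x = p ++ u ++ q ∧ y = p ++ v ++ q

/-- `IsColoring w x ms y`: there is a coloring of the stack `w` with the colors `x` at the bottom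
and `y` at the top, in which the colors above each slice are listed by `ms`. -/
inductive IsColoring : List Slice → List H → List (List H) → List H → Prop
  | nil (x : List H) : IsColoring [] x [] x
  | cons {s : Slice} {w : List Slice} {x m y : List H} {ms : List (List H)}
      (head : SliceRel s x m) (tail : IsColoring w m ms y) : IsColoring (s :: w) x (m :: ms) y

/-- Some coloring of the stack `w` has the colors `x` at the bottom and `y` at the top. -/
def Colorable (w : List Slice) (x y : List H) : Prop :=
  ∃ ms, IsColoring w x ms y

/-! #### Elementary slices -/

theorem TangleRel.length_bottom {k : Kind} {u v : List H} (h : TangleRel k u v) :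
    u.length = k.bottom := by
  cases h <;> rfl

theorem TangleRel.length_top {k : Kind} {u v : List H} (h : TangleRel k u v) :
    v.length = k.top := by
  cases h <;> rfl

theorem TangleRel.top_unique {k : Kind} {u v v' : List H} (hk : k ≠ .cup) (h : TangleRel k u v)
    (h' : TangleRel k u v') : v = v' := by
  cases h <;> cases h' <;> trivial

theorem TangleRel.bottom_unique {k : Kind} {u u' v : List H} (hk : k ≠ .cap)
    (h : TangleRel k u v) (h' : TangleRel k u' v) : u = u' := by
  cases h with
  | cup a => cases h'; rfl
  | cap a => exact absurd rfl hk
  | over_true a b =>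
    generalize hv : [a * b⁻¹ * a, a] = v at h'
    cases h' with | over_true a' b' =>
    obtain ⟨h, rfl, -⟩ : _ ∧ a = a' ∧ _ := by simpa only [List.cons.injEq] using hv
    rw [inv_injective (mul_left_cancel (mul_right_cancel h))]
  | over_false a b =>
    generalize hv : [a, a * b⁻¹ * a] = v at h'
    cases h' with | over_false a' b' =>
    obtain ⟨rfl, h, -⟩ : a = a' ∧ _ ∧ _ := by simpa only [List.cons.injEq] using hv
    rw [inv_injective (mul_left_cancel (mul_right_cancel h))]

theorem SliceRel.le_length {s : Slice} {x y : List H} (h : SliceRel s x y) :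
    s.pos + s.kind.bottom ≤ x.length := by
  obtain ⟨p, u, v, q, hp, huv, rfl, rfl⟩ := h
  simp only [List.length_append, huv.length_bottom, hp, Nat.le_add_right]

theorem SliceRel.length {s : Slice} {x y : List H} (h : SliceRel s x y) :
    y.length = x.length - s.kind.bottom + s.kind.top := by
  obtain ⟨p, u, v, q, hp, huv, rfl, rfl⟩ := h
  simp only [List.length_append, huv.length_bottom, huv.length_top]
  omega

theorem SliceRel.top_unique {s : Slice} {x y y' : List H} (hs : s.kind ≠ .cup)
    (h : SliceRel s x y) (h' : SliceRel s x y') : y = y' := by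
  obtain ⟨p, u, v, q, hp, huv, rfl, rfl⟩ := h
  obtain ⟨p', u', v', q', hp', huv', hx, rfl⟩ := h'
  simp only [List.append_assoc] at hx
  obtain ⟨rfl, huq⟩ := List.append_inj hx (hp.trans hp'.symm)
  obtain ⟨rfl, rfl⟩ := List.append_inj huq (huv.length_bottom.trans huv'.length_bottom.symm)
  rw [huv.top_unique hs huv']

theorem SliceRel.bottom_unique {s : Slice} {x x' y : List H} (hs : s.kind ≠ .cap)
    (h : SliceRel s x y) (h' : SliceRel s x' y) : x = x' := by
  obtain ⟨p, u, v, q, hp, huv, rfl, rfl⟩ := h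
  obtain ⟨p', u', v', q', hp', huv', rfl, hy⟩ := h'
  simp only [List.append_assoc] at hy
  obtain ⟨rfl, hvq⟩ := List.append_inj hy (hp.trans hp'.symm)
  obtain ⟨rfl, rfl⟩ := List.append_inj hvq (huv.length_top.trans huv'.length_top.symm)
  rw [huv.bottom_unique hs huv']

theorem sliceRel_cup_zero {x y : List H} :
    SliceRel (cup 0) x y ↔ ∃ a, y = a :: a :: x := by
  constructor
  · rintro ⟨p, u, v, q, hp, huv, rfl, rfl⟩
    obtain rfl := List.eq_nil_of_length_eq_zero hp
    cases huv with | cup a => exact ⟨a, rfl⟩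
  · rintro ⟨a, rfl⟩
    exact ⟨[], [], [a, a], x, rfl, .cup a, rfl, rfl⟩

theorem sliceRel_cap_zero {x y : List H} :
    SliceRel (cap 0) x y ↔ ∃ a, x = a :: a :: y := by
  constructor
  · rintro ⟨p, u, v, q, hp, huv, rfl, rfl⟩
    obtain rfl := List.eq_nil_of_length_eq_zero hp
    cases huv with | cap a => exact ⟨a, rfl⟩
  · rintro ⟨a, rfl⟩
    exact ⟨[], [a, a], [], y, rfl, .cap a, rfl, rfl⟩

theorem sliceRel_cross_zero_true {x y : List H} :
    SliceRel (cross 0 true) x y ↔ ∃ a b q, x = a :: b :: q ∧ y = (a * b⁻¹ * a) :: a :: q := by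
  constructor
  · rintro ⟨p, u, v, q, hp, huv, rfl, rfl⟩
    obtain rfl := List.eq_nil_of_length_eq_zero hp
    cases huv with | over_true a b => exact ⟨a, b, q, rfl, rfl⟩
  · rintro ⟨a, b, q, rfl, rfl⟩
    exact ⟨[], [a, b], _, q, rfl, .over_true a b, rfl, rfl⟩

theorem sliceRel_cross_zero_false {x y : List H} :
    SliceRel (cross 0 false) x y ↔ ∃ a b q, x = b :: a :: q ∧ y = a :: (a * b⁻¹ * a) :: q := by
  constructor
  · rintro ⟨p, u, v, q, hp, huv, rfl, rfl⟩
    obtain rfl := List.eq_nil_of_length_eq_zero hp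
    cases huv with | over_false a b => exact ⟨a, b, q, rfl, rfl⟩
  · rintro ⟨a, b, q, rfl, rfl⟩
    exact ⟨[], [b, a], _, q, rfl, .over_false a b, rfl, rfl⟩

/-! #### Strands to the left and to the right -/

/-- The slice with `i` further strands to its left. -/
def Slice.shift (i : ℕ) (s : Slice) : Slice := ⟨i + s.pos, s.kind⟩

theorem SliceRel.append_left {s : Slice} {x y : List H} (h : SliceRel s x y) (p : List H) :
    SliceRel (s.shift p.length) (p ++ x) (p ++ y) := by
  obtain ⟨p', u, v, q, hp', huv, rfl, rfl⟩ := h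
  exact ⟨p ++ p', u, v, q, by rw [List.length_append, hp']; rfl, huv,
    by simp only [List.append_assoc], by simp only [List.append_assoc]⟩

theorem sliceRel_append_left {s : Slice} {p x y : List H} :
    SliceRel (s.shift p.length) (p ++ x) y ↔ ∃ y', y = p ++ y' ∧ SliceRel s x y' := by
  refine ⟨?_, fun ⟨y', hy, h⟩ => hy ▸ h.append_left p⟩
  rintro ⟨p', u, v, q, hp', huv, hx, rfl⟩
  have hle : p.length ≤ p'.length := by rw [hp']; exact Nat.le_add_right _ _
  obtain ⟨p'', rfl⟩ : p <+: p' :=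
    List.prefix_of_prefix_length_le ⟨x, rfl⟩ ⟨u ++ q, by rw [hx, List.append_assoc]⟩ hle
  simp only [List.append_assoc, List.append_cancel_left_eq] at hx
  refine ⟨p'' ++ v ++ q, by simp only [List.append_assoc], p'', u, v, q, ?_, huv, ?_, rfl⟩
  · rw [List.length_append] at hp'
    exact Nat.add_left_cancel hp'
  · rw [hx, List.append_assoc]

theorem SliceRel.append_right {s : Slice} {x y : List H} (h : SliceRel s x y) (z : List H) :
    SliceRel s (x ++ z) (y ++ z) := by
  obtain ⟨p, u, v, q, hp, huv, rfl, rfl⟩ := h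
  exact ⟨p, u, v, q ++ z, hp, huv, by simp only [List.append_assoc],
    by simp only [List.append_assoc]⟩

theorem sliceRel_append_right {s : Slice} {x y z : List H}
    (hs : s.pos + s.kind.bottom ≤ x.length) :
    SliceRel s (x ++ z) y ↔ ∃ x', y = x' ++ z ∧ SliceRel s x x' := by
  refine ⟨?_, fun ⟨x', hy, h⟩ => hy ▸ h.append_right z⟩
  rintro ⟨p, u, v, q, hp, huv, hx, rfl⟩
  have hle : (p ++ u).length ≤ x.length := by
    rwa [List.length_append, hp, huv.length_bottom]
  obtain ⟨q', rfl⟩ : p ++ u <+: x := List.prefix_of_prefix_length_le ⟨q, hx.symm⟩ ⟨z, rfl⟩ hle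
  rw [List.append_assoc (p ++ u), List.append_cancel_left_eq] at hx
  obtain rfl := hx
  exact ⟨p ++ v ++ q', by simp only [List.append_assoc], p, u, v, q', hp, huv, rfl, rfl⟩

theorem sliceRel_succ {i : ℕ} {k : Kind} {x y : List H} :
    SliceRel ⟨i + 1, k⟩ x y ↔ ∃ c x' y', x = c :: x' ∧ y = c :: y' ∧ SliceRel ⟨i, k⟩ x' y' := by
  have shift_one : (⟨i + 1, k⟩ : Slice) = Slice.shift 1 ⟨i, k⟩ := by
    rw [Slice.shift, Nat.add_comm]
  rw [shift_one]
  constructor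
  · intro h
    obtain _ | ⟨c, x⟩ := x
    · exact absurd h.le_length (by simp [Slice.shift])
    · obtain ⟨y, rfl, hxy⟩ := (sliceRel_append_left (p := [c])).1 h
      exact ⟨c, x, y, rfl, rfl, hxy⟩
  · rintro ⟨c, x, y, rfl, rfl, h⟩
    exact h.append_left [c]

theorem SliceRel.between_unique {i j : ℕ} (hij : i ≠ j) {x m m' y : List H}
    (hcup : SliceRel (cup j) x m) (hcup' : SliceRel (cup j) x m')
    (hcap : SliceRel (cap i) m y) (hcap' : SliceRel (cap i) m' y) : m = m' := by
  induction i generalizing j x m m' y with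
  | zero =>
    obtain ⟨j, rfl⟩ := Nat.exists_eq_succ_of_ne_zero hij.symm
    obtain ⟨a, rfl⟩ := sliceRel_cap_zero.1 hcap
    obtain ⟨a', rfl⟩ := sliceRel_cap_zero.1 hcap'
    obtain ⟨c, x, y, rfl, hy, -⟩ := sliceRel_succ.1 hcup
    obtain ⟨c', x', y', hx, hy', -⟩ := sliceRel_succ.1 hcup'
    simp_all only [List.cons.injEq]
  | succ i ih =>
    obtain ⟨c, m, y, rfl, rfl, hm⟩ := sliceRel_succ.1 hcap
    obtain ⟨c', m', y', rfl, hy, hm'⟩ := sliceRel_succ.1 hcap'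
    obtain ⟨rfl, rfl⟩ := List.cons.inj hy
    cases j with
    | zero =>
      obtain ⟨a, h⟩ := sliceRel_cup_zero.1 hcup
      obtain ⟨a', h'⟩ := sliceRel_cup_zero.1 hcup'
      simp_all only [List.cons.injEq]
    | succ j =>
      obtain ⟨d, x, z, rfl, hz, hx⟩ := sliceRel_succ.1 hcup
      obtain ⟨d', x', z', hdx, hz', hx'⟩ := sliceRel_succ.1 hcup'
      obtain ⟨rfl, rfl⟩ := List.cons.inj hz
      obtain ⟨rfl, rfl⟩ := List.cons.inj hz'
      obtain ⟨-, rfl⟩ := List.cons.inj hdx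
      rw [ih (by omega) hx hx' hm hm']

/-! #### Stacks of slices -/

@[simp]
theorem colorable_nil {x y : List H} : Colorable [] x y ↔ y = x :=
  ⟨fun ⟨_, h⟩ => by cases h; rfl, fun h => h ▸ ⟨[], .nil y⟩⟩

@[simp]
theorem colorable_cons {s : Slice} {w : List Slice} {x y : List H} :
    Colorable (s :: w) x y ↔ ∃ m, SliceRel s x m ∧ Colorable w m y := by
  constructor
  · rintro ⟨_, h⟩
    cases h with | cons head tail => exact ⟨_, head, _, tail⟩
  · rintro ⟨m, h, ms, hms⟩
    exact ⟨m :: ms, .cons h hms⟩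

theorem IsColoring.append {u v : List Slice} {x y z : List H} {ms ns : List (List H)}
    (hu : IsColoring u x ms y) (hv : IsColoring v y ns z) :
    IsColoring (u ++ v) x (ms ++ ns) z := by
  induction hu with
  | nil => exact hv
  | cons head _ ih => exact .cons head (ih hv)

theorem isColoring_append {u v : List Slice} {x z : List H} {ms : List (List H)} :
    IsColoring (u ++ v) x ms z ↔
      ∃ ms₁ ms₂ y, ms = ms₁ ++ ms₂ ∧ IsColoring u x ms₁ y ∧ IsColoring v y ms₂ z := by
  refine ⟨fun h => ?_, fun ⟨ms₁, ms₂, y, hms, hu, hv⟩ => hms ▸ hu.append hv⟩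
  induction u generalizing x ms with
  | nil => exact ⟨[], ms, x, rfl, .nil x, h⟩
  | cons s u ih =>
    cases h with
    | cons head tail =>
      obtain ⟨ms₁, ms₂, y, rfl, hu, hv⟩ := ih tail
      exact ⟨_ :: ms₁, ms₂, y, rfl, .cons head hu, hv⟩

theorem colorable_append {u v : List Slice} {x z : List H} :
    Colorable (u ++ v) x z ↔ ∃ y, Colorable u x y ∧ Colorable v y z := by
  constructor
  · rintro ⟨ms, h⟩
    obtain ⟨ms₁, ms₂, y, -, hu, hv⟩ := isColoring_append.1 h
    exact ⟨y, ⟨ms₁, hu⟩, ⟨ms₂, hv⟩⟩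
  · rintro ⟨y, ⟨ms₁, hu⟩, ⟨ms₂, hv⟩⟩
    exact ⟨ms₁ ++ ms₂, hu.append hv⟩

theorem IsColoring.length {w : List Slice} {x y : List H} {ms : List (List H)}
    (h : IsColoring w x ms y) : ms.length = w.length := by
  induction h with
  | nil => rfl
  | cons _ _ ih => rw [List.length_cons, List.length_cons, ih]

theorem IsColoring.width {w : List Slice} {x y : List H} {ms : List (List H)}
    (h : IsColoring w x ms y) : width w x.length = some y.length := by
  induction h with
  | nil => rfl
  | cons head _ ih => rw [LinkDiag.width, if_pos head.le_length, ← head.length, ih]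

theorem colorable_append_left {w : List Slice} {p x y : List H} :
    Colorable (w.map (Slice.shift p.length)) (p ++ x) y ↔
      ∃ y', y = p ++ y' ∧ Colorable w x y' := by
  induction w generalizing x with
  | nil => simp only [List.map_nil, colorable_nil, exists_eq_right]
  | cons s w ih =>
    simp only [List.map_cons, colorable_cons, sliceRel_append_left]
    constructor
    · rintro ⟨_, ⟨m, rfl, hs⟩, hw⟩
      obtain ⟨y', rfl, hmy⟩ := ih.1 hw
      exact ⟨y', rfl, m, hs, hmy⟩
    · rintro ⟨y', rfl, m, hs, hw⟩
      exact ⟨p ++ m, ⟨m, rfl, hs⟩, ih.2 ⟨y', rfl, hw⟩⟩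

theorem IsColoring.top_unique {w : List Slice} (hw : ∀ s ∈ w, s.kind ≠ .cup) {x y y' : List H}
    {ms ms' : List (List H)} (h : IsColoring w x ms y) (h' : IsColoring w x ms' y') :
    ms = ms' ∧ y = y' := by
  induction h generalizing ms' with
  | nil => cases h'; exact ⟨rfl, rfl⟩
  | cons head _ ih =>
    cases h' with
    | cons head' tail' =>
      rw [List.forall_mem_cons] at hw
      obtain rfl := head.top_unique hw.1 head'
      obtain ⟨rfl, rfl⟩ := ih hw.2 tail'
      exact ⟨rfl, rfl⟩

theorem isColoring_singleton {s : Slice} {x y : List H} {ms : List (List H)} :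
    IsColoring [s] x ms y ↔ ms = [y] ∧ SliceRel s x y := by
  constructor
  · intro h
    cases h with | cons head tail => cases tail; exact ⟨rfl, head⟩
  · rintro ⟨rfl, h⟩
    exact .cons h (.nil y)

/-- Only a minimum with a maximum on top of it is a circle, whose color is arbitrary. -/
theorem IsColoring.pair_unique {s t : Slice}
    (hst : s.kind ≠ .cup ∨ t.kind ≠ .cap ∨ t.pos ≠ s.pos) {x y : List H} {ms ms' : List (List H)}
    (h : IsColoring [s, t] x ms y) (h' : IsColoring [s, t] x ms' y) : ms = ms' := by
  obtain ⟨i, k⟩ := s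
  obtain ⟨j, l⟩ := t
  cases h with
  | @cons _ _ _ m _ _ hs ht =>
  cases h' with
  | @cons _ _ _ m' _ _ hs' ht' =>
  obtain ⟨rfl, hm⟩ := isColoring_singleton.1 ht
  obtain ⟨rfl, hm'⟩ := isColoring_singleton.1 ht'
  suffices m = m' by rw [this]
  by_cases hk : k = .cup
  · by_cases hl : l = .cap
    · subst hk hl
      exact hs.between_unique (by simpa only [ne_eq, not_true_eq_false, false_or] using hst)
        hs' hm hm'
    · exact hm.bottom_unique hl hm'
  · exact hs.top_unique hk hs'

/-! #### Changing the colors -/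

/-- A map that commutes with the core operation `(a, b) ↦ a b⁻¹ a`, such as a homomorphism or a
left translation. -/
def PreservesCore (f : G → H) : Prop :=
  ∀ a b, f (a * b⁻¹ * a) = f a * (f b)⁻¹ * f a

theorem preservesCore_hom (φ : G →* H) : PreservesCore φ := fun a b => by
  rw [map_mul, map_mul, map_inv]

theorem preservesCore_mul_left (g : H) : PreservesCore (g * ·) := fun a b => by
  group

theorem TangleRel.map {f : G → H} (hf : PreservesCore f) {k : Kind} {u v : List G}
    (h : TangleRel k u v) : TangleRel k (u.map f) (v.map f) := by
  cases h with
  | cup a => exact .cup (f a)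
  | cap a => exact .cap (f a)
  | over_true a b => simpa only [List.map, hf a b] using .over_true (f a) (f b)
  | over_false a b => simpa only [List.map, hf a b] using .over_false (f a) (f b)

theorem SliceRel.map {f : G → H} (hf : PreservesCore f) {s : Slice} {x y : List G}
    (h : SliceRel s x y) : SliceRel s (x.map f) (y.map f) := by
  obtain ⟨p, u, v, q, hp, huv, rfl, rfl⟩ := h
  exact ⟨p.map f, u.map f, v.map f, q.map f, by rw [List.length_map, hp], huv.map hf,
    by simp only [List.map_append], by simp only [List.map_append]⟩

theorem IsColoring.map {f : G → H} (hf : PreservesCore f) {w : List Slice} {x y : List G}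
    {ms : List (List G)} (h : IsColoring w x ms y) :
    IsColoring w (x.map f) (ms.map (List.map f)) (y.map f) := by
  induction h with
  | nil => exact .nil _
  | cons head _ ih => exact .cons (head.map hf) ih

end Colorings

/-! ### Invariance of colorings under the moves -/

section Invariance

variable {H : Type*} [Group H]

/-- On at least `N` strands the stacks `l` and `r` admit colorings in `H` with the same colors at
the bottom and at the top. -/
def SameColorings (H : Type*) [Group H] (N : ℕ) (l r : List Slice) : Prop :=
  ∀ x y : List H, N ≤ x.length → (Colorable l x y ↔ Colorable r x y)

theorem SameColorings.shift {N : ℕ} {l r : List Slice} (h : SameColorings H N l r) (i : ℕ) :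
    SameColorings H (i + N) (l.map (Slice.shift i)) (r.map (Slice.shift i)) := by
  intro x y hx
  obtain ⟨p, q, rfl, rfl⟩ : ∃ p q, p.length = i ∧ p ++ q = x :=
    ⟨_, _, List.length_take_of_le (by omega), x.take_append_drop i⟩
  rw [colorable_append_left, colorable_append_left]
  refine exists_congr fun y' => and_congr_right fun _ => h q y' ?_
  rw [List.length_append] at hx
  omega

theorem sameColorings_exchange (A B : Kind) (i d : ℕ) :
    SameColorings H (i + A.bottom + d) [⟨i + A.bottom + d, B⟩, ⟨i, A⟩]
      [⟨i, A⟩, ⟨i + A.top + d, B⟩] := by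
  intro x y hx
  obtain ⟨p, q, hp, rfl⟩ : ∃ p q, p.length = i + A.bottom + d ∧ p ++ q = x :=
    ⟨_, _, List.length_take_of_le hx, x.take_append_drop _⟩
  have hA (q y : List H) : SliceRel ⟨i, A⟩ (p ++ q) y ↔
      ∃ p', y = p' ++ q ∧ SliceRel ⟨i, A⟩ p p' :=
    sliceRel_append_right (by simp only [hp, Nat.le_add_right])
  have hB {j : ℕ} {p : List H} (hp : p.length = j) (y : List H) :
      SliceRel ⟨j, B⟩ (p ++ q) y ↔ ∃ q', y = p ++ q' ∧ SliceRel ⟨0, B⟩ q q' := by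
    subst hp
    exact sliceRel_append_left (s := ⟨0, B⟩)
  have hB_top {p' : List H} (hp' : SliceRel ⟨i, A⟩ p p') : p'.length = i + A.top + d := by
    rw [hp'.length, hp]
    simp only
    omega
  simp only [colorable_cons, colorable_nil, exists_eq_right', hB hp, hA]
  constructor
  · rintro ⟨_, ⟨q', rfl, hq⟩, h⟩
    obtain ⟨p', rfl, hp'⟩ := (hA _ _).1 h
    exact ⟨_, ⟨p', rfl, hp'⟩, (hB (hB_top hp') _).2 ⟨q', rfl, hq⟩⟩
  · rintro ⟨_, ⟨p', rfl, hp'⟩, h⟩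
    obtain ⟨q', rfl, hq⟩ := (hB (hB_top hp') _).1 h
    exact ⟨_, ⟨q', rfl, hq⟩, (hA _ _).2 ⟨p', rfl, hp'⟩⟩

/-! #### The moves next to the left margin -/

theorem sliceRel_cup_one {x y : List H} :
    SliceRel (cup 1) x y ↔ ∃ c q a, x = c :: q ∧ y = c :: a :: a :: q := by
  refine sliceRel_succ.trans ?_
  simp only [← cup.eq_1, sliceRel_cup_zero]
  exact ⟨fun ⟨c, q, _, hx, hy, a, h⟩ => ⟨c, q, a, hx, h ▸ hy⟩,
    fun ⟨c, q, a, hx, hy⟩ => ⟨c, q, _, hx, hy, a, rfl⟩⟩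

theorem sliceRel_cap_one {x y : List H} :
    SliceRel (cap 1) x y ↔ ∃ c a q, x = c :: a :: a :: q ∧ y = c :: q := by
  refine sliceRel_succ.trans ?_
  simp only [← cap.eq_1, sliceRel_cap_zero]
  exact ⟨fun ⟨c, _, q, hx, hy, a, h⟩ => ⟨c, a, q, h ▸ hx, hy⟩,
    fun ⟨c, a, q, hx, hy⟩ => ⟨c, _, q, hx, hy, a, rfl⟩⟩

theorem sliceRel_cross_one_true {x y : List H} :
    SliceRel (cross 1 true) x y ↔
      ∃ c a b q, x = c :: a :: b :: q ∧ y = c :: (a * b⁻¹ * a) :: a :: q := by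
  refine sliceRel_succ.trans ?_
  simp only [← cross.eq_1, sliceRel_cross_zero_true]
  exact ⟨fun ⟨c, _, _, hx, hy, a, b, q, h, h'⟩ => ⟨c, a, b, q, h ▸ hx, h' ▸ hy⟩,
    fun ⟨c, a, b, q, hx, hy⟩ => ⟨c, _, _, hx, hy, a, b, q, rfl, rfl⟩⟩

theorem sliceRel_cross_one_false {x y : List H} :
    SliceRel (cross 1 false) x y ↔
      ∃ c a b q, x = c :: b :: a :: q ∧ y = c :: a :: (a * b⁻¹ * a) :: q := by
  refine sliceRel_succ.trans ?_
  simp only [← cross.eq_1, sliceRel_cross_zero_false]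
  exact ⟨fun ⟨c, _, _, hx, hy, a, b, q, h, h'⟩ => ⟨c, a, b, q, h ▸ hx, h' ▸ hy⟩,
    fun ⟨c, a, b, q, hx, hy⟩ => ⟨c, _, _, hx, hy, a, b, q, rfl, rfl⟩⟩

attribute [local simp] sliceRel_cup_zero sliceRel_cap_zero sliceRel_cross_zero_true
  sliceRel_cross_zero_false sliceRel_cup_one sliceRel_cap_one sliceRel_cross_one_true
  sliceRel_cross_one_false

theorem sameColorings_zigzag_left : SameColorings H 1 [cup 0, cap 1] [] := by
  intro x y hx
  obtain ⟨a, q, rfl⟩ := List.exists_cons_of_length_pos hx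
  simp

theorem sameColorings_zigzag_right : SameColorings H 1 [cup 1, cap 0] [] := by
  intro x y hx
  obtain ⟨a, q, rfl⟩ := List.exists_cons_of_length_pos hx
  simp [eq_comm (a := y)]

theorem eq_core_iff_eq_core {a b c : H} : b = a * c⁻¹ * a ↔ c = a * b⁻¹ * a := by
  constructor <;> rintro rfl <;> group

theorem sameColorings_slide_cap (s : Bool) :
    SameColorings H 3 [cross 0 s, cap 1] [cross 1 (!s), cap 0] := by
  intro x y hx
  match x, hx with
  | a :: b :: c :: q, _ => cases s <;> simp +contextual [eq_comm, eq_core_iff_eq_core]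

theorem sameColorings_slide_cup (s : Bool) :
    SameColorings H 1 [cup 1, cross 0 s] [cup 0, cross 1 (!s)] := by
  intro x y hx
  obtain ⟨a, q, rfl⟩ := List.exists_cons_of_length_pos hx
  cases s with
  | false => simp
  | true =>
    have reparametrize : (∃ c, y = a * c⁻¹ * a :: a :: c :: q) ↔
        ∃ c, y = c :: a :: a * c⁻¹ * a :: q := by
      constructor
      · rintro ⟨c, rfl⟩
        exact ⟨_, by rw [← eq_core_iff_eq_core.2 rfl]⟩
      · rintro ⟨c, rfl⟩
        exact ⟨a * c⁻¹ * a, by rw [← eq_core_iff_eq_core.2 rfl]⟩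
    simpa using reparametrize

theorem sameColorings_reidemeister_one_cap (s : Bool) :
    SameColorings H 2 [cross 0 s, cap 0] [cap 0] := by
  intro x y hx
  match x, hx with
  | a :: b :: q, _ => cases s <;> simp [mul_inv_eq_one, eq_comm]

theorem sameColorings_reidemeister_one_cup (s : Bool) :
    SameColorings H 0 [cup 0, cross 0 s] [cup 0] := by
  intro x y _
  cases s <;> simp

theorem sameColorings_reidemeister_two (s : Bool) :
    SameColorings H 2 [cross 0 s, cross 0 (!s)] [] := by
  intro x y hx
  match x, hx with
  | a :: b :: q, _ => cases s <;> simp [mul_assoc]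

theorem sameColorings_reidemeister_three {s₁ s₂ s₃ : Bool} (h : s₂ = s₁ ∨ s₂ = s₃) :
    SameColorings H 3 [cross 0 s₁, cross 1 s₂, cross 0 s₃]
      [cross 1 s₃, cross 0 s₂, cross 1 s₁] := by
  intro x y hx
  match x, hx with
  | a :: b :: c :: q, _ =>
    obtain rfl | rfl := h
    · cases s₂ <;> cases s₃ <;> simp [mul_assoc]
    · cases s₁ <;> cases s₂ <;> simp [mul_assoc]

theorem colorable_replicate_cross_true {n : ℕ} {a b : H} {q y : List H} :
    Colorable (List.replicate n (cross 0 true)) (a :: b :: q) y ↔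
      y = (a * b⁻¹) ^ n * a :: (a * b⁻¹) ^ n * b :: q := by
  induction n generalizing a b with
  | zero => simp
  | succ n ih =>
    simp [List.replicate_succ, ih, pow_succ, mul_assoc]

theorem colorable_replicate_cross_false {n : ℕ} {a b : H} {q y : List H} :
    Colorable (List.replicate n (cross 0 false)) (b :: a :: q) y ↔
      y = (a * b⁻¹) ^ n * b :: (a * b⁻¹) ^ n * a :: q := by
  induction n generalizing a b with
  | zero => simp
  | succ n ih =>
    simp [List.replicate_succ, ih, pow_succ, mul_assoc]

theorem sameColorings_nMove {n : ℕ} (hH : ∀ h : H, h ^ n = 1) (s : Bool) :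
    SameColorings H 2 (List.replicate n (cross 0 s)) [] := by
  intro x y hx
  match x, hx, s with
  | a :: b :: q, _, true => simp [colorable_replicate_cross_true, hH]
  | a :: b :: q, _, false => simp [colorable_replicate_cross_false, hH]

/-! #### All moves -/

theorem width_cons_eq_some {s : Slice} {w : List Slice} {n m : ℕ} :
    width (s :: w) n = some m ↔
      s.pos + s.kind.bottom ≤ n ∧ width w (n - s.kind.bottom + s.kind.top) = some m := by
  rw [width, ite_eq_iff]
  simp only [reduceCtorEq, and_false, or_false]

theorem SameColorings.mono {N M : ℕ} {l r : List Slice} (h : SameColorings H N l r) (hNM : N ≤ M) :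
    SameColorings H M l r :=
  fun x y hx => h x y (hNM.trans hx)

theorem IsotopyRule.sameColorings {l r : List Slice} (h : IsotopyRule l r) {k m : ℕ}
    (hl : width l k = some m) : SameColorings H k l r := by
  cases h <;> simp only [width_cons_eq_some, cup, cap, cross] at hl
  case exchange A B i d =>
    exact (sameColorings_exchange A B i d).mono (by omega)
  all_goals simp only [Kind.bottom, Kind.top] at hl
  case zigzag_left i =>
    exact (sameColorings_zigzag_left.shift i).mono (by omega)
  case zigzag_right i =>
    exact (sameColorings_zigzag_right.shift i).mono (by omega)
  case slide_cap i s =>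
    exact ((sameColorings_slide_cap s).shift i).mono (by omega)
  case slide_cup i s =>
    exact ((sameColorings_slide_cup s).shift i).mono (by omega)
  case reidemeister_one_cap i s =>
    exact ((sameColorings_reidemeister_one_cap s).shift i).mono (by omega)
  case reidemeister_one_cup i s =>
    exact ((sameColorings_reidemeister_one_cup s).shift i).mono (by omega)
  case reidemeister_two i s =>
    exact ((sameColorings_reidemeister_two s).shift i).mono (by omega)
  case reidemeister_three i s₁ s₂ s₃ h =>
    exact ((sameColorings_reidemeister_three h).shift i).mono (by omega)

theorem Rule.sameColorings {n : ℕ} (hH : ∀ h : H, h ^ n = 1) {l r : List Slice} (h : Rule n l r)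
    {k m : ℕ} (hl : width l k = some m) : SameColorings H k l r := by
  cases h with
  | isotopy h => exact h.sameColorings hl
  | nMove i s =>
    cases n with
    | zero => exact fun _ _ _ => Iff.rfl
    | succ n =>
      have hik : i + 2 ≤ k := (width_cons_eq_some.1 hl).1
      have := ((sameColorings_nMove hH s).shift i).mono hik
      rwa [List.map_replicate] at this

/-- A coloring of the stack `w` is determined by the colors at its bottom and at its top. -/
def DeterminedByEnds (H : Type*) [Group H] (w : List Slice) : Prop :=
  ∀ ⦃x y : List H⦄ ⦃ms ms' : List (List H)⦄, IsColoring w x ms y → IsColoring w x ms' y → ms = ms'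

theorem determinedByEnds_of_forall_ne_cup {w : List Slice} (hw : ∀ s ∈ w, s.kind ≠ .cup) :
    DeterminedByEnds H w :=
  fun _ _ _ _ h h' => (h.top_unique hw h').1

theorem determinedByEnds_singleton (s : Slice) : DeterminedByEnds H [s] :=
  fun _ _ _ _ h h' => (isColoring_singleton.1 h).1.trans (isColoring_singleton.1 h').1.symm

theorem determinedByEnds_pair {s t : Slice}
    (hst : s.kind ≠ .cup ∨ t.kind ≠ .cap ∨ t.pos ≠ s.pos) : DeterminedByEnds H [s, t] :=
  fun _ _ _ _ h h' => h.pair_unique hst h'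

theorem Rule.determinedByEnds {n : ℕ} {l r : List Slice} (h : Rule n l r) :
    DeterminedByEnds H l ∧ DeterminedByEnds H r := by
  have nil : DeterminedByEnds H [] :=
    determinedByEnds_of_forall_ne_cup fun _ hs => absurd hs List.not_mem_nil
  cases h with
  | nMove i s =>
    refine ⟨determinedByEnds_of_forall_ne_cup fun t ht => ?_, nil⟩
    rw [List.eq_of_mem_replicate ht]
    exact Kind.noConfusion
  | isotopy h =>
    cases h with
    | exchange A B i d =>
      refine ⟨determinedByEnds_pair ?_, determinedByEnds_pair ?_⟩
      · by_cases hA : A = .cap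
        · exact .inr (.inr (by simp only [hA, Kind.bottom]; omega))
        · exact .inr (.inl hA)
      · by_cases hA : A = .cup
        · exact .inr (.inr (by simp only [hA, Kind.top]; omega))
        · exact .inl hA
    | zigzag_left i | zigzag_right i => exact ⟨determinedByEnds_pair (by simp [cup, cap]), nil⟩
    | slide_cap i s | slide_cup i s =>
      exact ⟨determinedByEnds_pair (by simp [cup, cap, cross]),
        determinedByEnds_pair (by simp [cup, cap, cross])⟩
    | reidemeister_one_cap i s | reidemeister_one_cup i s =>
      exact ⟨determinedByEnds_pair (by simp [cup, cap, cross]), determinedByEnds_singleton _⟩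
    | reidemeister_two i s => exact ⟨determinedByEnds_pair (by simp [cross]), nil⟩
    | reidemeister_three i s₁ s₂ s₃ h =>
      exact ⟨determinedByEnds_of_forall_ne_cup (by simp [cross]),
        determinedByEnds_of_forall_ne_cup (by simp [cross])⟩

theorem Rule.width_pos {n : ℕ} (hn : n ≠ 0) {l r : List Slice} (h : Rule n l r) {m : ℕ}
    (hl : width l 0 = some m) : 0 < m := by
  cases h with
  | nMove i s =>
    obtain ⟨n, rfl⟩ := Nat.exists_eq_succ_of_ne_zero hn
    simp [List.replicate_succ, width_cons_eq_some, cross, Kind.bottom] at hl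
  | isotopy h =>
    cases h <;> simp only [width_cons_eq_some, cup, cap, cross] at hl
    case exchange A B i d =>
      cases A <;> cases B <;> simp [width, Kind.bottom, Kind.top] at hl; omega
    all_goals simp [width, Kind.bottom, Kind.top] at hl; try omega

end Invariance

/-! ### The universal coloring of a diagram -/

section UniversalColoring

variable {G H : Type*} [Group G] [Group H] {D : LinkDiagram}

/-! #### Colors of single strands -/

theorem SliceRel.getElem?_eq_of_through {s : Slice} {x y : List H} (h : SliceRel s x y) {i j : ℕ}
    (hij : Through s i j) : x[i]? = y[j]? := by
  obtain ⟨p, u, v, q, hp, huv, rfl, rfl⟩ := h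
  cases hij with
  | left _ _ hi =>
    rw [← hp] at hi
    simp only [List.append_assoc, List.getElem?_append_left hi]
  | right _ d =>
    have right_getElem? (u : List H) : (p ++ u ++ q)[s.pos + u.length + d]? = q[d]? := by
      rw [← hp, ← List.length_append, List.getElem?_append_right (Nat.le_add_right _ _),
        Nat.add_sub_cancel_left]
    rw [← huv.length_bottom, ← huv.length_top, right_getElem?, right_getElem?]
  | over_true i =>
    obtain rfl : p.length = i := hp
    generalize hk : (cross p.length true).kind = k at huv
    cases huv <;> simp_all [cross]
  | over_false i =>
    obtain rfl : p.length = j := hp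
    generalize hk : (cross p.length false).kind = k at huv
    cases huv <;> simp_all [cross]

theorem SliceRel.getElem?_cup {i : ℕ} {x y : List H} (h : SliceRel (cup i) x y) :
    y[i]? = y[i + 1]? := by
  obtain ⟨p, u, v, q, rfl, huv, rfl, rfl⟩ := h
  cases huv with | cup a => simp

theorem SliceRel.getElem?_cap {i : ℕ} {x y : List H} (h : SliceRel (cap i) x y) :
    x[i]? = x[i + 1]? := by
  obtain ⟨p, u, v, q, rfl, huv, rfl, rfl⟩ := h
  cases huv with | cap a => simp

theorem SliceRel.getElem?_cross_true {i : ℕ} {x y : List H} (h : SliceRel (cross i true) x y)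
    {a b : H} (ha : x[i]? = some a) (hb : x[i + 1]? = some b) : y[i]? = some (a * b⁻¹ * a) := by
  obtain ⟨p, u, v, q, rfl, huv, rfl, rfl⟩ := h
  cases huv with | over_true a' b' => simp_all

theorem SliceRel.getElem?_cross_false {i : ℕ} {x y : List H} (h : SliceRel (cross i false) x y)
    {a b : H} (ha : x[i + 1]? = some a) (hb : x[i]? = some b) :
    y[i + 1]? = some (a * b⁻¹ * a) := by
  obtain ⟨p, u, v, q, rfl, huv, rfl, rfl⟩ := h
  cases huv with | over_false a' b' => simp_all

theorem sliceRel_map_range {f g : ℕ → H} {s : Slice} {r : ℕ} (left : ∀ j < s.pos, f j = g j)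
    (right : ∀ d < r, f (s.pos + s.kind.bottom + d) = g (s.pos + s.kind.top + d))
    (middle : TangleRel s.kind ((List.range s.kind.bottom).map fun j => f (s.pos + j))
      ((List.range s.kind.top).map fun j => g (s.pos + j))) :
    SliceRel s ((List.range (s.pos + s.kind.bottom + r)).map f)
      ((List.range (s.pos + s.kind.top + r)).map g) := by
  refine ⟨(List.range s.pos).map f, _, _,
    (List.range r).map fun d => f (s.pos + s.kind.bottom + d), by simp, middle, ?_, ?_⟩
  · simp [List.range_add, Function.comp_def]
  · have hleft : (List.range s.pos).map f = (List.range s.pos).map g :=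
      List.map_congr_left fun j hj => left j (List.mem_range.1 hj)
    have hright : (List.range r).map (fun d => f (s.pos + s.kind.bottom + d)) =
        (List.range r).map fun d => g (s.pos + s.kind.top + d) :=
      List.map_congr_left fun d hd => right d (List.mem_range.1 hd)
    rw [hleft, hright]
    simp [List.range_add, Function.comp_def]

/-! #### Colorings of diagrams -/

/-- A coloring of a diagram by a group, encoded by the lists of colors above each slice. -/
@[ext]
structure Coloring (D : LinkDiagram) (H : Type*) [Group H] where
  colors : List (List H)
  isColoring : IsColoring D.word [] colors []

/-- The colors on the `k`th horizontal line. -/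
def Coloring.level (c : Coloring D H) (k : ℕ) : List H := (([] : List H) :: c.colors).getD k []

/-- The color of a strand; the default value `1` is never attained. -/
def Coloring.color (c : Coloring D H) (p : Strand D) : H := (c.level p.level).getD p.pos 1

theorem IsColoring.getD_length {w : List Slice} {x y : List H} {ms : List (List H)}
    (h : IsColoring w x ms y) (ns : List (List H)) : (x :: (ms ++ ns)).getD w.length [] = y := by
  induction h with
  | nil => rfl
  | cons _ _ ih => exact ih

theorem IsColoring.sliceRel_getD {w : List Slice} {x y : List H} {ms : List (List H)}
    (h : IsColoring w x ms y) {k : ℕ} {s : Slice} (hk : w[k]? = some s) :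
    SliceRel s ((x :: ms).getD k []) ((x :: ms).getD (k + 1) []) := by
  induction h generalizing k with
  | nil => simp at hk
  | cons head _ ih =>
    cases k with
    | zero =>
      obtain rfl : _ = s := Option.some_injective _ hk
      exact head
    | succ k => exact ih hk

theorem Coloring.sliceRel_level (c : Coloring D H) {k : ℕ} {s : Slice}
    (hk : D.word[k]? = some s) : SliceRel s (c.level k) (c.level (k + 1)) :=
  c.isColoring.sliceRel_getD hk

theorem Coloring.level_length_eq (c : Coloring D H) {w : List Slice} {ms ms' : List (List H)}
    (hc : c.colors = ms ++ ms') {x : List H} (h : IsColoring w [] ms x) :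
    c.level w.length = x := by
  rw [Coloring.level, hc, h.getD_length]

theorem Coloring.width_take (c : Coloring D H) {k : ℕ} (hk : k ≤ D.word.length) :
    width (D.word.take k) 0 = some (c.level k).length := by
  have h : IsColoring (D.word.take k ++ D.word.drop k) [] c.colors [] := by
    rw [List.take_append_drop]
    exact c.isColoring
  obtain ⟨ms, ms', x, hc, hx, -⟩ := isColoring_append.1 h
  have hlevel := c.level_length_eq hc hx
  rw [List.length_take_of_le hk] at hlevel
  rw [hlevel]
  exact hx.width

theorem Strand.level_le (p : Strand D) : p.level ≤ D.word.length := by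
  by_contra! h
  obtain ⟨n, hn, hp⟩ := p.valid
  rw [List.take_of_length_le h.le, D.closed] at hn
  exact Nat.not_lt_zero _ (Option.some_injective _ hn ▸ hp)

theorem Coloring.getElem?_level (c : Coloring D H) (p : Strand D) :
    (c.level p.level)[p.pos]? = some (c.color p) := by
  obtain ⟨n, hn, hp⟩ := p.valid
  rw [c.width_take p.level_le, Option.some_inj] at hn
  rw [Coloring.color, List.getD_eq_getElem _ _ (hn ▸ hp), List.getElem?_eq_getElem]

theorem Coloring.ext_color {c d : Coloring D H} (h : ∀ p : Strand D, c.color p = d.color p) :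
    c = d := by
  have level_eq {k : ℕ} (hk : k ≤ D.word.length) : c.level k = d.level k := by
    have hlength : (c.level k).length = (d.level k).length :=
      Option.some_injective _ ((c.width_take hk).symm.trans (d.width_take hk))
    refine List.ext_getElem hlength fun j hc hd => Option.some_injective _ ?_
    let p : Strand D := ⟨k, j, _, c.width_take hk, hc⟩
    rw [← List.getElem?_eq_getElem hc, ← List.getElem?_eq_getElem hd, c.getElem?_level p,
      d.getElem?_level p, h p]
  refine Coloring.ext (List.ext_getElem
    (c.isColoring.length.trans d.isColoring.length.symm) fun k hc hd => ?_)
  have hk := level_eq (k := k + 1) (c.isColoring.length ▸ hc)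
  rwa [Coloring.level, Coloring.level, List.getD_cons_succ, List.getD_cons_succ,
    List.getD_eq_getElem _ _ hc, List.getD_eq_getElem _ _ hd] at hk

/-- The image of a coloring under a map that preserves the core operation. -/
def Coloring.map {f : G → H} (hf : PreservesCore f) (c : Coloring D G) : Coloring D H :=
  ⟨c.colors.map (List.map f), c.isColoring.map hf⟩

theorem Coloring.level_map {f : G → H} (hf : PreservesCore f) (c : Coloring D G) (k : ℕ) :
    (c.map hf).level k = (c.level k).map f := by
  change (([] :: c.colors).map (List.map f)).getD k (List.map f []) = _
  rw [List.getD_map]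
  rfl

theorem Coloring.color_map {f : G → H} (hf : PreservesCore f) (c : Coloring D G) (p : Strand D) :
    (c.map hf).color p = f (c.color p) := by
  apply Option.some_injective
  rw [← getElem?_level, level_map, List.getElem?_map, c.getElem?_level, Option.map_some]

theorem Coloring.lift_coreRelator (c : Coloring D H) {r : FreeGroup (Strand D)}
    (hr : CoreRelator D r) : FreeGroup.lift c.color r = 1 := by
  cases hr with
  | through s p q hs hq h =>
    have hpq := (c.sliceRel_level hs).getElem?_eq_of_through h
    rw [← hq, c.getElem?_level, c.getElem?_level, Option.some_inj] at hpq
    simp [hpq]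
  | cup i p q k hs hp hq =>
    have hpq := (c.sliceRel_level hs).getElem?_cup
    rw [← hq.2, ← hp.2, ← hp.1, c.getElem?_level p, hp.1, ← hq.1, c.getElem?_level q,
      Option.some_inj] at hpq
    simp [hpq]
  | cap i p q k hs hp hq =>
    have hpq := (c.sliceRel_level hs).getElem?_cap
    rw [← hq.2, ← hp.2, ← hp.1, c.getElem?_level p, hp.1, ← hq.1, c.getElem?_level q,
      Option.some_inj] at hpq
    simp [hpq]
  | crossing_true i p q r k hs hp hq hr =>
    have hpqr := (c.sliceRel_level hs).getElem?_cross_true (hp.1 ▸ hp.2 ▸ c.getElem?_level p)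
      (hq.1 ▸ hq.2 ▸ c.getElem?_level q)
    rw [← hr.1, ← hr.2, c.getElem?_level, Option.some_inj] at hpqr
    simp [hpqr]
  | crossing_false i p q r k hs hp hq hr =>
    have hpqr := (c.sliceRel_level hs).getElem?_cross_false (hp.1 ▸ hp.2 ▸ c.getElem?_level p)
      (hq.1 ▸ hq.2 ▸ c.getElem?_level q)
    rw [← hr.1, ← hr.2, c.getElem?_level, Option.some_inj] at hpqr
    simp [hpqr]

/-- The homomorphism of the core group that sends each arc to its color. -/
def Coloring.hom (c : Coloring D H) : CoreGroup D →* H :=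
  PresentedGroup.toGroup fun _ hr => c.lift_coreRelator hr

theorem Coloring.hom_arc (c : Coloring D H) (p : Strand D) : c.hom (arc p) = c.color p :=
  PresentedGroup.toGroup.of _

/-! #### The coloring by the core group -/

theorem arc_eq_arc {p q : Strand D} (h : CoreRelator D (.of p * (.of q)⁻¹)) :
    arc p = arc q := by
  have hone := PresentedGroup.one_of_mem (rels := {r | CoreRelator D r}) h
  rwa [map_mul, map_inv, mul_inv_eq_one] at hone

theorem arc_eq_core {a b c : Strand D}
    (h : CoreRelator D (.of c * (.of a * (.of b)⁻¹ * .of a)⁻¹)) :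
    arc c = arc a * (arc b)⁻¹ * arc a := by
  have hone := PresentedGroup.one_of_mem (rels := {r | CoreRelator D r}) h
  simp only [map_mul, map_inv] at hone
  exact mul_inv_eq_one.1 hone

/-- The number of strands on the `k`th horizontal line of a diagram. -/
def LinkDiagram.levelWidth (D : LinkDiagram) (k : ℕ) : ℕ := (width (D.word.take k) 0).getD 0

theorem LinkDiagram.width_take (D : LinkDiagram) (k : ℕ) :
    width (D.word.take k) 0 = some (D.levelWidth k) := by
  have h : width (D.word.take k ++ D.word.drop k) 0 = some 0 := by
    rw [List.take_append_drop]
    exact D.closed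
  rw [width_append, Option.bind_eq_some_iff] at h
  obtain ⟨n, hn, -⟩ := h
  rw [levelWidth, hn, Option.getD_some]

theorem LinkDiagram.levelWidth_succ (D : LinkDiagram) {k : ℕ} {s : Slice}
    (hs : D.word[k]? = some s) : ∃ r, D.levelWidth k = s.pos + s.kind.bottom + r ∧
      D.levelWidth (k + 1) = s.pos + s.kind.top + r := by
  have h := D.width_take (k + 1)
  rw [List.take_add_one, hs, width_append, D.width_take k] at h
  obtain ⟨hle, htop⟩ := width_cons_eq_some.1 h
  refine ⟨D.levelWidth k - s.pos - s.kind.bottom, by omega, ?_⟩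
  have := Option.some_injective _ htop
  omega

open Classical in
/-- The class of the `j`th strand on the `k`th horizontal line, and `1` if there is no such
strand. -/
def coreColor (D : LinkDiagram) (k j : ℕ) : CoreGroup D :=
  if h : j < D.levelWidth k then arc ⟨k, j, _, D.width_take k, h⟩ else 1

theorem coreColor_of_lt {k j : ℕ} (h : j < D.levelWidth k) :
    coreColor D k j = arc ⟨k, j, _, D.width_take k, h⟩ := dif_pos h

theorem coreColor_eq_of_through {k : ℕ} {s : Slice} (hs : D.word[k]? = some s) {i j : ℕ}
    (hij : Through s i j) (hi : i < D.levelWidth k) (hj : j < D.levelWidth (k + 1)) :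
    coreColor D k i = coreColor D (k + 1) j := by
  rw [coreColor_of_lt hi, coreColor_of_lt hj]
  exact arc_eq_arc (.through s _ _ hs rfl hij)

theorem tangleRel_coreColor {k : ℕ} {s : Slice} (hs : D.word[k]? = some s) :
    TangleRel s.kind ((List.range s.kind.bottom).map fun j => coreColor D k (s.pos + j))
      ((List.range s.kind.top).map fun j => coreColor D (k + 1) (s.pos + j)) := by
  obtain ⟨r, hbottom, htop⟩ := D.levelWidth_succ hs
  have strand {l j : ℕ} (hj : j < D.levelWidth l) : ∃ p : Strand D,
      (p.level = l ∧ p.pos = j) ∧ coreColor D l j = arc p :=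
    ⟨_, ⟨rfl, rfl⟩, coreColor_of_lt hj⟩
  obtain ⟨i, _ | _ | _ | _⟩ := s <;> simp only [Kind.bottom, Kind.top, add_zero] at hbottom htop
  · obtain ⟨p, hp, hpc⟩ := strand (l := k + 1) (j := i) (by omega)
    obtain ⟨q, hq, hqc⟩ := strand (l := k + 1) (j := i + 1) (by omega)
    change TangleRel _ [] [coreColor D (k + 1) i, coreColor D (k + 1) (i + 1)]
    rw [hpc, hqc, arc_eq_arc (.cup i p q k hs hp hq)]
    exact .cup _
  · obtain ⟨p, hp, hpc⟩ := strand (l := k) (j := i) (by omega)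
    obtain ⟨q, hq, hqc⟩ := strand (l := k) (j := i + 1) (by omega)
    change TangleRel _ [coreColor D k i, coreColor D k (i + 1)] []
    rw [hpc, hqc, arc_eq_arc (.cap i p q k hs hp hq)]
    exact .cap _
  · obtain ⟨a, ha, hac⟩ := strand (l := k) (j := i + 1) (by omega)
    obtain ⟨b, hb, hbc⟩ := strand (l := k) (j := i) (by omega)
    obtain ⟨c, hc, hcc⟩ := strand (l := k + 1) (j := i + 1) (by omega)
    change TangleRel _ [coreColor D k i, coreColor D k (i + 1)]
      [coreColor D (k + 1) i, coreColor D (k + 1) (i + 1)]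
    rw [← coreColor_eq_of_through hs (.over_false i) (by omega) (by omega), hac, hbc, hcc,
      arc_eq_core (.crossing_false i a b c k hs ha hb hc)]
    exact .over_false _ _
  · obtain ⟨a, ha, hac⟩ := strand (l := k) (j := i) (by omega)
    obtain ⟨b, hb, hbc⟩ := strand (l := k) (j := i + 1) (by omega)
    obtain ⟨c, hc, hcc⟩ := strand (l := k + 1) (j := i) (by omega)
    change TangleRel _ [coreColor D k i, coreColor D k (i + 1)]
      [coreColor D (k + 1) i, coreColor D (k + 1) (i + 1)]
    rw [← coreColor_eq_of_through hs (.over_true i) (by omega) (by omega), hac, hbc, hcc,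
      arc_eq_core (.crossing_true i a b c k hs ha hb hc)]
    exact .over_true _ _

theorem sliceRel_coreColor {k : ℕ} {s : Slice} (hs : D.word[k]? = some s) :
    SliceRel s ((List.range (D.levelWidth k)).map (coreColor D k))
      ((List.range (D.levelWidth (k + 1))).map (coreColor D (k + 1))) := by
  obtain ⟨r, hbottom, htop⟩ := D.levelWidth_succ hs
  rw [hbottom, htop]
  exact sliceRel_map_range
    (fun j hj => coreColor_eq_of_through hs (.left s j hj) (by omega) (by omega))
    (fun d hd => coreColor_eq_of_through hs (.right s d) (by omega) (by omega))
    (tangleRel_coreColor hs)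

theorem isColoring_of_levels {w : List Slice} (L : ℕ → List H)
    (h : ∀ k s, w[k]? = some s → SliceRel s (L k) (L (k + 1))) :
    IsColoring w (L 0) ((List.range w.length).map fun k => L (k + 1)) (L w.length) := by
  induction w generalizing L with
  | nil => exact .nil _
  | cons s w ih =>
    rw [List.length_cons, List.range_succ_eq_map, List.map_cons, List.map_map]
    exact .cons (h 0 s rfl) (ih (fun k => L (k + 1)) fun k t hk => h (k + 1) t hk)

/-- The tautological coloring of a diagram by its core group. -/
def coreColoring (D : LinkDiagram) : Coloring D (CoreGroup D) :=
  ⟨(List.range D.word.length).map fun k =>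
      (List.range (D.levelWidth (k + 1))).map (coreColor D (k + 1)), by
    have h := isColoring_of_levels (fun k => (List.range (D.levelWidth k)).map (coreColor D k))
      (w := D.word) fun _ _ => sliceRel_coreColor
    simpa [LinkDiagram.levelWidth, D.closed, width] using h⟩

theorem coreColoring_level {k : ℕ} (hk : k ≤ D.word.length) :
    (coreColoring D).level k = (List.range (D.levelWidth k)).map (coreColor D k) := by
  cases k with
  | zero => rfl
  | succ k =>
    rw [Coloring.level, List.getD_cons_succ, coreColoring,
      List.getD_eq_getElem _ _ (by rwa [List.length_map, List.length_range]), List.getElem_map,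
      List.getElem_range]

theorem coreColoring_color (p : Strand D) : (coreColoring D).color p = arc p := by
  obtain ⟨n, hn, hp⟩ := p.valid
  rw [D.width_take, Option.some_inj] at hn
  rw [← hn] at hp
  apply Option.some_injective
  rw [← Coloring.getElem?_level, coreColoring_level p.level_le, List.getElem?_map,
    List.getElem?_range hp, Option.map_some, coreColor_of_lt hp]

/-! #### The coloring by the Burnside group -/

variable {n : ℕ}

/-- The class of an arc in the unreduced Burnside group. -/
def burnsideArc (n : ℕ) (p : Strand D) : CoreBurnside n D := QuotientGroup.mk (arc p)

/-- The tautological coloring of a diagram by its unreduced Burnside group. -/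
def burnsideColoring (n : ℕ) (D : LinkDiagram) : Coloring D (CoreBurnside n D) :=
  (coreColoring D).map (preservesCore_hom (QuotientGroup.mk' _))

theorem burnsideColoring_color (p : Strand D) :
    (burnsideColoring n D).color p = burnsideArc n p := by
  rw [burnsideColoring, Coloring.color_map, coreColoring_color]
  rfl

theorem coreBurnside_hom_ext {φ ψ : CoreBurnside n D →* H}
    (h : ∀ p : Strand D, φ (burnsideArc n p) = ψ (burnsideArc n p)) : φ = ψ :=
  QuotientGroup.monoidHom_ext _ (PresentedGroup.ext h)

/-- The unreduced Burnside group represents the colorings by groups of exponent `n`. -/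
def coloringEquiv (hH : ∀ h : H, h ^ n = 1) (D : LinkDiagram) :
    (CoreBurnside n D →* H) ≃ Coloring D H where
  toFun φ := (burnsideColoring n D).map (preservesCore_hom φ)
  invFun c := BurnsideQuotient.lift hH c.hom
  left_inv φ := coreBurnside_hom_ext fun p => by
    rw [burnsideArc, BurnsideQuotient.lift_mk, Coloring.hom_arc, Coloring.color_map,
      burnsideColoring_color]
    rfl
  right_inv c := Coloring.ext_color fun p => by
    rw [Coloring.color_map, burnsideColoring_color, burnsideArc, BurnsideQuotient.lift_mk,
      Coloring.hom_arc]

end UniversalColoring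

/-! ### Invariance of the unreduced Burnside group -/

section StepInvariance

variable {G H : Type*} [Group G] [Group H] {D E : LinkDiagram} {n : ℕ} {u l r v : List Slice}

/-- The colorings `c` of `u ++ l ++ v` and `d` of `u ++ r ++ v` agree on `u` and on `v`. -/
def AgreeOutside (u l r v : List Slice) (c : Coloring D H) (d : Coloring E H) : Prop :=
  ∃ ms₁ ms₂ ms₂' ms₃ x y, c.colors = ms₁ ++ ms₂ ++ ms₃ ∧ d.colors = ms₁ ++ ms₂' ++ ms₃ ∧
    IsColoring u [] ms₁ x ∧ IsColoring l x ms₂ y ∧ IsColoring r x ms₂' y ∧ IsColoring v y ms₃ []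

theorem AgreeOutside.symm {c : Coloring D H} {d : Coloring E H} (h : AgreeOutside u l r v c d) :
    AgreeOutside u r l v d c := by
  obtain ⟨ms₁, ms₂, ms₂', ms₃, x, y, hc, hd, hu, hl, hr, hv⟩ := h
  exact ⟨ms₁, ms₂', ms₂, ms₃, x, y, hd, hc, hu, hr, hl, hv⟩

theorem AgreeOutside.map {f : G → H} (hf : PreservesCore f) {c : Coloring D G}
    {d : Coloring E G} (h : AgreeOutside u l r v c d) :
    AgreeOutside u l r v (c.map hf) (d.map hf) := by
  obtain ⟨ms₁, ms₂, ms₂', ms₃, x, y, hc, hd, hu, hl, hr, hv⟩ := h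
  refine ⟨_, _, _, _, _, _, ?_, ?_, hu.map hf, hl.map hf, hr.map hf, hv.map hf⟩
  · simp only [Coloring.map, hc, List.map_append]
  · simp only [Coloring.map, hd, List.map_append]

theorem AgreeOutside.right_unique (hr : DeterminedByEnds H r) {c : Coloring D H}
    {d d' : Coloring E H} (h : AgreeOutside u l r v c d) (h' : AgreeOutside u l r v c d') :
    d = d' := by
  obtain ⟨ms₁, ms₂, ms₂', ms₃, x, y, hc, hd, hu, hl, hx, -⟩ := h
  obtain ⟨ns₁, ns₂, ns₂', ns₃, x', y', hc', hd', hu', hl', hx', -⟩ := h'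
  obtain rfl : x = x' := by
    rw [List.append_assoc] at hc hc'
    exact (c.level_length_eq hc hu).symm.trans (c.level_length_eq hc' hu')
  obtain rfl : y = y' :=
    (c.level_length_eq hc (hu.append hl)).symm.trans (c.level_length_eq hc' (hu'.append hl'))
  obtain ⟨h₁₂, rfl⟩ := List.append_inj (hc.symm.trans hc') (by
    simp only [List.length_append, hu.length, hu'.length, hl.length, hl'.length])
  obtain ⟨rfl, -⟩ := List.append_inj h₁₂ (hu.length.trans hu'.length.symm)
  exact Coloring.ext (by rw [hd, hd', hr hx hx'])

theorem AgreeOutside.left_unique (hl : DeterminedByEnds H l) {c c' : Coloring D H}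
    {d : Coloring E H} (h : AgreeOutside u l r v c d) (h' : AgreeOutside u l r v c' d) : c = c' :=
  h.symm.right_unique hl h'.symm

theorem exists_agreeOutside (hD : D.word = u ++ l ++ v) (hE : E.word = u ++ r ++ v)
    (hlr : ∀ x y : List H, Colorable u [] x → Colorable l x y → Colorable r x y)
    (c : Coloring D H) : ∃ d : Coloring E H, AgreeOutside u l r v c d := by
  obtain ⟨ms, hc⟩ := c
  have hc' := hc
  rw [hD] at hc'
  obtain ⟨_, ms₃, y, rfl, hul, hv⟩ := isColoring_append.1 hc'
  obtain ⟨ms₁, ms₂, x, rfl, hu, hl⟩ := isColoring_append.1 hul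
  obtain ⟨ms₂', hr⟩ := hlr x y ⟨ms₁, hu⟩ ⟨ms₂, hl⟩
  exact ⟨⟨ms₁ ++ ms₂' ++ ms₃, hE ▸ (hu.append hr).append hv⟩,
    ms₁, ms₂, ms₂', ms₃, x, y, rfl, rfl, hu, hl, hr, hv⟩

theorem Rule.colorable_iff (h : Rule n l r) (hH : ∀ h : H, h ^ n = 1)
    (hD : D.word = u ++ l ++ v) {x y : List H} (hx : Colorable u [] x) :
    Colorable l x y ↔ Colorable r x y := by
  obtain ⟨ms, hms⟩ := hx
  have hwidth : width (u ++ (l ++ v)) 0 = some 0 := by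
    rw [← List.append_assoc, ← hD]
    exact D.closed
  have hu : width u 0 = some x.length := hms.width
  rw [width_append, hu, Option.bind_some, width_append, Option.bind_eq_some_iff] at hwidth
  obtain ⟨m, hm, -⟩ := hwidth
  exact h.sameColorings hH hm x y le_rfl

/-- The Yoneda lemma: as both unreduced Burnside groups represent colorings, the natural bijection
between colorings that agree outside the move comes from an isomorphism. -/
theorem Rule.exists_mulEquiv (h : Rule n l r) (hD : D.word = u ++ l ++ v)
    (hE : E.word = u ++ r ++ v) : ∃ Φ : CoreBurnside n D ≃* CoreBurnside n E,
      AgreeOutside u l r v ((burnsideColoring n D).map (preservesCore_hom Φ.toMonoidHom))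
        (burnsideColoring n E) := by
  have exponentD : ∀ x : CoreBurnside n D, x ^ n = 1 := BurnsideQuotient.pow_eq_one
  have exponentE : ∀ x : CoreBurnside n E, x ^ n = 1 := BurnsideQuotient.pow_eq_one
  obtain ⟨d, hd⟩ := exists_agreeOutside hD hE
    (fun x y hx => (h.colorable_iff exponentD hD hx).1) (burnsideColoring n D)
  obtain ⟨c, hc⟩ := exists_agreeOutside hE hD
    (fun x y hx => (h.colorable_iff exponentE hD hx).2) (burnsideColoring n E)
  obtain ⟨f, rfl⟩ : ∃ f, (burnsideColoring n D).map (preservesCore_hom f) = c :=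
    (coloringEquiv exponentE D).surjective c
  obtain ⟨g, rfl⟩ : ∃ g, (burnsideColoring n E).map (preservesCore_hom g) = d :=
    (coloringEquiv exponentD E).surjective d
  have hgf := (hc.symm.map (preservesCore_hom g)).left_unique h.determinedByEnds.1 hd
  have hfg := (hd.map (preservesCore_hom f)).right_unique h.determinedByEnds.2 hc.symm
  refine ⟨f.toMulEquiv g (coreBurnside_hom_ext fun p => ?_) (coreBurnside_hom_ext fun p => ?_),
    hc.symm⟩
  · have := congrArg (·.color p) hgf
    simp only [Coloring.color_map, burnsideColoring_color] at this
    exact this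
  · have := congrArg (·.color p) hfg
    simp only [Coloring.color_map, burnsideColoring_color] at this
    exact this

theorem Coloring.exists_color_eq {c : Coloring D H} {d : Coloring E H} {j k : ℕ} {x : List H}
    (hj : j ≤ D.word.length) (hk : k ≤ E.word.length) (hc : c.level j = x) (hd : d.level k = x)
    (hx : x ≠ []) : ∃ p q, c.color p = d.color q := by
  have hpos := List.length_pos_of_ne_nil hx
  let p : Strand D := ⟨j, 0, _, c.width_take hj, hc ▸ hpos⟩
  let q : Strand E := ⟨k, 0, _, d.width_take hk, hd ▸ hpos⟩
  refine ⟨p, q, Option.some_injective _ ?_⟩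
  rw [← c.getElem?_level p, ← d.getElem?_level q]
  exact congrArg (·[0]?) (hc.trans hd.symm)

theorem AgreeOutside.exists_color_eq (hD : D.word = u ++ l ++ v) (hE : E.word = u ++ r ++ v)
    (hl : ∀ m, width l 0 = some m → 0 < m) {c : Coloring D H} {d : Coloring E H}
    (h : AgreeOutside u l r v c d) : ∃ p q, c.color p = d.color q := by
  obtain ⟨ms₁, ms₂, ms₂', ms₃, x, y, hc, hd, hu, hx, hx', -⟩ := h
  by_cases hxnil : x = []
  · have hy : y ≠ [] := List.ne_nil_of_length_pos (hl _ (by rw [hx.width.symm, hxnil]; rfl))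
    exact Coloring.exists_color_eq (by simp [hD]) (by simp [hE])
      (c.level_length_eq hc (hu.append hx)) (d.level_length_eq hd (hu.append hx')) hy
  · rw [List.append_assoc] at hc hd
    exact Coloring.exists_color_eq (by simp [hD]) (by simp [hE]) (c.level_length_eq hc hu)
      (d.level_length_eq hd hu) hxnil

theorem Step.exists_mulEquiv (hn : n ≠ 0) (h : Step n D E) :
    ∃ (Φ : CoreBurnside n D ≃* CoreBurnside n E) (p : Strand D) (q : Strand E),
      Φ (burnsideArc n p) = burnsideArc n q := by
  obtain ⟨u, l, r, v, hlr, hD, hE⟩ := h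
  obtain ⟨Φ, hΦ⟩ := hlr.exists_mulEquiv hD hE
  obtain ⟨p, q, hpq⟩ := hΦ.exists_color_eq hD hE fun _ => hlr.width_pos hn
  rw [Coloring.color_map, burnsideColoring_color, burnsideColoring_color] at hpq
  exact ⟨Φ, p, q, hpq⟩

end StepInvariance

/-! ### The reduced Burnside group -/

section ReducedBurnsideGroup

variable {H : Type*} [Group H] {n : ℕ} {D E : LinkDiagram}

/-- The class of the arc `p` in the Burnside group in which the arc `e` is put equal to `1`. -/
def linkArc (n : ℕ) (e p : Strand D) : LinkBurnside n D e :=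
  QuotientGroup.mk (QuotientGroup.mk (arc p))

theorem linkArc_self (n : ℕ) (e : Strand D) : linkArc n e e = 1 := by
  have h : (QuotientGroup.mk (arc e) : DoubleCoverGroup D e) = 1 :=
    (QuotientGroup.eq_one_iff _).2 (Subgroup.subset_normalClosure rfl)
  rw [linkArc, h]
  rfl

theorem linkBurnside_hom_ext {e : Strand D} {φ ψ : LinkBurnside n D e →* H}
    (h : ∀ p : Strand D, φ (linkArc n e p) = ψ (linkArc n e p)) : φ = ψ :=
  QuotientGroup.monoidHom_ext _ (QuotientGroup.monoidHom_ext _ (PresentedGroup.ext h))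

/-- The projection of the unreduced onto the reduced Burnside group. -/
def burnsideProj (n : ℕ) (e : Strand D) : CoreBurnside n D →* LinkBurnside n D e :=
  BurnsideQuotient.lift BurnsideQuotient.pow_eq_one
    ((QuotientGroup.mk' _).comp (QuotientGroup.mk' _))

theorem burnsideProj_burnsideArc (e p : Strand D) :
    burnsideProj n e (burnsideArc n p) = linkArc n e p := rfl

/-- The tautological coloring of a diagram by its reduced Burnside group. -/
def linkColoring (n : ℕ) (e : Strand D) : Coloring D (LinkBurnside n D e) :=
  (burnsideColoring n D).map (preservesCore_hom (burnsideProj n e))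

theorem linkColoring_color (e p : Strand D) : (linkColoring n e).color p = linkArc n e p := by
  rw [linkColoring, Coloring.color_map, burnsideColoring_color, burnsideProj_burnsideArc]

/-- The left translate of a coloring. -/
def Coloring.translate (g : H) (c : Coloring D H) : Coloring D H :=
  c.map (preservesCore_mul_left g)

theorem Coloring.translate_color (g : H) (c : Coloring D H) (p : Strand D) :
    (c.translate g).color p = g * c.color p :=
  c.color_map _ p

/-- The homomorphism of the reduced Burnside group that corresponds to the left translate of a
coloring in which `e` has the color `1`. -/
def Coloring.linkHom (hH : ∀ h : H, h ^ n = 1) (c : Coloring D H) (e : Strand D) :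
    LinkBurnside n D e →* H :=
  BurnsideQuotient.lift hH <| QuotientGroup.lift _ (c.translate (c.color e)⁻¹).hom <|
    show Subgroup.normalClosure {arc e} ≤ (c.translate (c.color e)⁻¹).hom.ker from
      Subgroup.normalClosure_le_normal <| Set.singleton_subset_iff.2 <| by
        rw [SetLike.mem_coe, MonoidHom.mem_ker, hom_arc, translate_color, inv_mul_cancel]

theorem Coloring.linkHom_linkArc (hH : ∀ h : H, h ^ n = 1) (c : Coloring D H) (e p : Strand D) :
    c.linkHom hH e (linkArc n e p) = (c.color e)⁻¹ * c.color p :=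
  ((c.translate _).hom_arc p).trans (c.translate_color _ p)

theorem linkHom_comp_linkHom (d e : Strand D) :
    ((linkColoring n d).linkHom BurnsideQuotient.pow_eq_one e).comp
      ((linkColoring n e).linkHom BurnsideQuotient.pow_eq_one d) = .id _ :=
  linkBurnside_hom_ext fun p => by
    simp only [MonoidHom.comp_apply, Coloring.linkHom_linkArc, linkColoring_color, map_mul, map_inv,
      linkArc_self, mul_inv_cancel_left, MonoidHom.id_apply, mul_one, inv_inv]

/-- The reduced Burnside group does not depend on the arc put equal to `1`. -/
def linkBurnsideEquiv (n : ℕ) (d e : Strand D) : LinkBurnside n D d ≃* LinkBurnside n D e :=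
  ((linkColoring n e).linkHom BurnsideQuotient.pow_eq_one d).toMulEquiv
    ((linkColoring n d).linkHom BurnsideQuotient.pow_eq_one e)
    (linkHom_comp_linkHom d e) (linkHom_comp_linkHom e d)

theorem exists_linkBurnside_hom (Φ : CoreBurnside n D →* CoreBurnside n E) {p : Strand D}
    {q : Strand E} (h : Φ (burnsideArc n p) = burnsideArc n q) :
    ∃ f : LinkBurnside n D p →* LinkBurnside n E q,
      ∀ x, f (burnsideProj n p x) = burnsideProj n q (Φ x) := by
  let ψ := (burnsideProj n q).comp Φ
  let f := ((burnsideColoring n D).map (preservesCore_hom ψ)).linkHom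
    BurnsideQuotient.pow_eq_one p
  have hcomp : f.comp (burnsideProj n p) = ψ := coreBurnside_hom_ext fun s => by
    rw [MonoidHom.comp_apply, burnsideProj_burnsideArc, Coloring.linkHom_linkArc,
      Coloring.color_map, Coloring.color_map, burnsideColoring_color, burnsideColoring_color]
    simp only [ψ, MonoidHom.comp_apply, h, burnsideProj_burnsideArc, linkArc_self, inv_one,
      one_mul]
  exact ⟨f, DFunLike.congr_fun hcomp⟩

theorem nonempty_linkBurnside_mulEquiv (Φ : CoreBurnside n D ≃* CoreBurnside n E) {p : Strand D}
    {q : Strand E} (h : Φ (burnsideArc n p) = burnsideArc n q) :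
    Nonempty (LinkBurnside n D p ≃* LinkBurnside n E q) := by
  obtain ⟨f, hf⟩ := exists_linkBurnside_hom Φ.toMonoidHom h
  obtain ⟨g, hg⟩ := exists_linkBurnside_hom Φ.symm.toMonoidHom (Φ.symm_apply_eq.2 h.symm)
  refine ⟨f.toMulEquiv g (linkBurnside_hom_ext fun s => ?_) (linkBurnside_hom_ext fun s => ?_)⟩ <;>
    simp only [← burnsideProj_burnsideArc, MonoidHom.comp_apply, hf, hg,
      MulEquiv.toMonoidHom_eq_coe, MonoidHom.coe_coe, MulEquiv.symm_apply_apply,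
      MulEquiv.apply_symm_apply, MonoidHom.id_apply]

theorem MoveEquiv.burnside_equiv (hn : n ≠ 0) (h : MoveEquiv n D E) :
    Nonempty (CoreBurnside n D ≃* CoreBurnside n E) ∧
      (∀ (d : Strand D) (e : Strand E), Nonempty (LinkBurnside n D d ≃* LinkBurnside n E e)) ∧
      (Nonempty (Strand D) ↔ Nonempty (Strand E)) := by
  induction h with
  | rel D E h =>
    obtain ⟨Φ, p, q, hpq⟩ := h.exists_mulEquiv hn
    refine ⟨⟨Φ⟩, fun d e => ?_, fun _ => ⟨q⟩, fun _ => ⟨p⟩⟩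
    obtain ⟨f⟩ := nonempty_linkBurnside_mulEquiv Φ hpq
    exact ⟨(linkBurnsideEquiv n d p).trans (f.trans (linkBurnsideEquiv n q e))⟩
  | refl D => exact ⟨⟨.refl _⟩, fun d e => ⟨linkBurnsideEquiv n d e⟩, Iff.rfl⟩
  | symm D E _ ih =>
    obtain ⟨⟨f⟩, h, hs⟩ := ih
    exact ⟨⟨f.symm⟩, fun e d => (h d e).map MulEquiv.symm, hs.symm⟩
  | trans D E F _ _ ih₁ ih₂ =>
    obtain ⟨⟨f⟩, h, hs⟩ := ih₁
    obtain ⟨⟨g⟩, h', hs'⟩ := ih₂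
    refine ⟨⟨f.trans g⟩, fun d e => ?_, hs.trans hs'⟩
    obtain ⟨m⟩ := hs.1 ⟨d⟩
    obtain ⟨a⟩ := h d m
    obtain ⟨b⟩ := h' m e
    exact ⟨a.trans b⟩

/-- A coloring is a color of the arc `e` together with a coloring in which `e` has the color `1`,
by left translation. -/
def coloringEquivProd (hH : ∀ h : H, h ^ n = 1) (e : Strand D) :
    Coloring D H ≃ H × (LinkBurnside n D e →* H) where
  toFun c := (c.color e, c.linkHom hH e)
  invFun x := ((linkColoring n e).map (preservesCore_hom x.2)).translate x.1
  left_inv c := Coloring.ext_color fun p => by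
    rw [Coloring.translate_color, Coloring.color_map, linkColoring_color, Coloring.linkHom_linkArc,
      mul_inv_cancel_left]
  right_inv x := by
    have color_eq (p : Strand D) : (((linkColoring n e).map (preservesCore_hom x.2)).translate
        x.1).color p = x.1 * x.2 (linkArc n e p) := by
      rw [Coloring.translate_color, Coloring.color_map, linkColoring_color]
    refine Prod.ext ?_ (linkBurnside_hom_ext fun p => ?_)
    · exact (color_eq e).trans (by rw [linkArc_self, map_one, mul_one])
    · rw [Coloring.linkHom_linkArc, color_eq, color_eq, linkArc_self, map_one, mul_one,
        inv_mul_cancel_left]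

theorem card_coreBurnside_hom (hH : ∀ h : H, h ^ n = 1) :
    Nat.card (CoreBurnside n D →* H) = Nat.card (Coloring D H) :=
  Nat.card_congr (coloringEquiv hH D)

theorem card_coreBurnside_hom_eq_mul (hH : ∀ h : H, h ^ n = 1) (e : Strand D) :
    Nat.card (CoreBurnside n D →* H) = Nat.card H * Nat.card (LinkBurnside n D e →* H) := by
  rw [card_coreBurnside_hom hH, Nat.card_congr (coloringEquivProd hH e), Nat.card_prod]

end ReducedBurnsideGroup

/-! ### Colorings of closed braids -/

section ClosedBraidColorings

variable {G H : Type*} [Group G] [Group H] {N : ℕ} {b : BraidWord N}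

/-! #### Minima and maxima -/

theorem closingCups_succ (n : ℕ) : closingCups (n + 1) = closingCups n ++ [cup n] := by
  rw [closingCups, List.range_succ, List.map_append]
  rfl

theorem closingCaps_succ (n : ℕ) : closingCaps (n + 1) = cap n :: closingCaps n := by
  rw [closingCaps, List.range_succ, List.reverse_append]
  rfl

theorem sliceRel_cup_append {p x y : List H} :
    SliceRel (cup p.length) (p ++ x) y ↔ ∃ a, y = p ++ a :: a :: x := by
  have h := sliceRel_append_left (s := cup 0) (p := p) (x := x) (y := y)
  simp only [sliceRel_cup_zero] at h
  exact h.trans ⟨fun ⟨_, hy, a, ha⟩ => ⟨a, ha ▸ hy⟩, fun ⟨a, hy⟩ => ⟨_, hy, a, rfl⟩⟩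

theorem sliceRel_cap_append {p x y : List H} :
    SliceRel (cap p.length) (p ++ x) y ↔ ∃ a z, x = a :: a :: z ∧ y = p ++ z := by
  have h := sliceRel_append_left (s := cap 0) (p := p) (x := x) (y := y)
  simp only [sliceRel_cap_zero] at h
  exact h.trans ⟨fun ⟨z, hy, a, ha⟩ => ⟨a, z, ha, hy⟩, fun ⟨a, z, ha, hy⟩ => ⟨z, hy, a, ha⟩⟩

theorem colorable_closingCups {n : ℕ} {z : List H} :
    Colorable (closingCups n) [] z ↔ ∃ t, t.length = n ∧ z = t ++ t.reverse := by
  induction n generalizing z with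
  | zero => simp [closingCups]
  | succ n ih =>
    simp only [closingCups_succ, colorable_append, colorable_cons, colorable_nil, ih]
    constructor
    · rintro ⟨_, ⟨t, rfl, rfl⟩, _, h, rfl⟩
      obtain ⟨a, rfl⟩ := sliceRel_cup_append.1 h
      exact ⟨t ++ [a], by simp, by simp⟩
    · rintro ⟨t, ht, rfl⟩
      obtain ⟨t, a, rfl⟩ := List.eq_nil_or_concat' t |>.resolve_left (by rintro rfl; simp at ht)
      obtain rfl : t.length = n := by simpa using ht
      exact ⟨_, ⟨t, rfl, rfl⟩, _, sliceRel_cup_append.2 ⟨a, rfl⟩, by simp⟩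

theorem colorable_closingCaps {n : ℕ} {z : List H} :
    Colorable (closingCaps n) z [] ↔ ∃ t, t.length = n ∧ z = t ++ t.reverse := by
  induction n generalizing z with
  | zero => simp [closingCaps, eq_comm]
  | succ n ih =>
    simp only [closingCaps_succ, colorable_cons, ih]
    constructor
    · rintro ⟨_, h, t, rfl, rfl⟩
      obtain ⟨p, z, hp, rfl⟩ : ∃ p q, p.length = t.length ∧ z = p ++ q :=
        ⟨_, _, List.length_take_of_le ((Nat.le_add_right _ _).trans h.le_length),
          (List.take_append_drop _ z).symm⟩
      rw [← hp] at h
      obtain ⟨a, y, rfl, hy⟩ := sliceRel_cap_append.1 h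
      obtain ⟨rfl, rfl⟩ := List.append_inj hy hp.symm
      exact ⟨t ++ [a], by simp, by simp⟩
    · rintro ⟨t, ht, rfl⟩
      obtain ⟨t, a, rfl⟩ := List.eq_nil_or_concat' t |>.resolve_left (by rintro rfl; simp at ht)
      obtain rfl : t.length = n := by simpa using ht
      exact ⟨_, by
        rw [List.append_assoc]
        exact sliceRel_cap_append.2 ⟨a, t.reverse, by simp, rfl⟩, t, rfl, rfl⟩

theorem kind_ne_cap_of_mem_closingCups {n : ℕ} {s : Slice} (hs : s ∈ closingCups n) :
    s.kind ≠ .cap := by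
  obtain ⟨i, -, rfl⟩ := List.mem_map.1 hs
  exact nofun

theorem kind_ne_cup_of_mem_closingCaps {n : ℕ} {s : Slice} (hs : s ∈ closingCaps n) :
    s.kind ≠ .cup := by
  obtain ⟨i, -, rfl⟩ := List.mem_map.1 hs
  exact nofun

theorem BraidWord.kind_ne_cup_of_mem_slices {s : Slice} (hs : s ∈ b.slices) : s.kind ≠ .cup := by
  obtain ⟨x, -, rfl⟩ := List.mem_map.1 hs
  exact nofun

theorem IsColoring.bottom_unique {w : List Slice} (hw : ∀ s ∈ w, s.kind ≠ .cap)
    {x x' y : List H} {ms ms' : List (List H)} (h : IsColoring w x ms y)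
    (h' : IsColoring w x' ms' y) : ms = ms' ∧ x = x' := by
  induction h generalizing x' ms' with
  | nil => cases h'; exact ⟨rfl, rfl⟩
  | cons head _ ih =>
    cases h' with
    | cons head' tail' =>
      rw [List.forall_mem_cons] at hw
      obtain ⟨rfl, rfl⟩ := ih hw.2 tail'
      exact ⟨rfl, head.bottom_unique hw.1 head'⟩

/-! #### Braids -/

theorem exists_sliceRel_cross {i : ℕ} (s : Bool) {x : List H} (h : i + 2 ≤ x.length) :
    ∃ y, SliceRel (cross i s) x y := by
  obtain ⟨p, a, b, q, hp, rfl⟩ : ∃ p a b q, p.length = i ∧ x = p ++ [a, b] ++ q :=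
    ⟨x.take i, x[i], x[i + 1], x.drop (i + 2), List.length_take_of_le (by omega), by simp⟩
  cases s with
  | false => exact ⟨_, p, _, _, q, hp, .over_false b a, rfl, rfl⟩
  | true => exact ⟨_, p, _, _, q, hp, .over_true a b, rfl, rfl⟩

theorem SliceRel.length_cross {i : ℕ} {s : Bool} {x y : List H} (h : SliceRel (cross i s) x y) :
    y.length = x.length := by
  rw [h.length]
  exact Nat.sub_add_cancel ((Nat.le_add_left _ _).trans h.le_length)

theorem BraidWord.exists_colorable (b : BraidWord N) {x : List H} (hx : x.length = N) :
    ∃ y, Colorable b.slices x y := by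
  induction b generalizing x with
  | nil => exact ⟨x, colorable_nil.2 rfl⟩
  | cons g b ih =>
    obtain ⟨m, hm⟩ := exists_sliceRel_cross (i := g.1) g.2 (x := x) (by omega)
    obtain ⟨y, hy⟩ := ih (hm.length_cross.trans hx)
    exact ⟨y, colorable_cons.2 ⟨m, hm, hy⟩⟩

theorem BraidWord.colorable_slices_append_right {x z y : List H} (hx : x.length = N) :
    Colorable b.slices (x ++ z) y ↔ ∃ x', y = x' ++ z ∧ Colorable b.slices x x' := by
  induction b generalizing x with
  | nil => simp [slices]
  | cons g b ih =>
    have hg : (cross g.1 g.2).pos + (cross g.1 g.2).kind.bottom ≤ x.length := by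
      simp only [cross, Kind.bottom]
      omega
    change Colorable (cross g.1 g.2 :: slices b) _ _ ↔
      ∃ x', _ ∧ Colorable (cross g.1 g.2 :: slices b) x x'
    simp only [colorable_cons, sliceRel_append_right hg]
    constructor
    · rintro ⟨_, ⟨m, rfl, hm⟩, h⟩
      obtain ⟨x', rfl, hx'⟩ := (ih (hm.length_cross.trans hx)).1 h
      exact ⟨x', rfl, m, hm, hx'⟩
    · rintro ⟨x', rfl, m, hm, hx'⟩
      exact ⟨m ++ z, ⟨m, rfl, hm⟩, (ih (hm.length_cross.trans hx)).2 ⟨x', rfl, hx'⟩⟩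

theorem BraidWord.colorable_slices_unique {x y y' : List H} (h : Colorable b.slices x y)
    (h' : Colorable b.slices x y') : y = y' := by
  obtain ⟨_, h⟩ := h
  obtain ⟨_, h'⟩ := h'
  exact (h.top_unique (fun _ => kind_ne_cup_of_mem_slices) h').2

/-! #### Closures -/

/-- The colors of the strands of a braid at its bottom, in a coloring of its closure. -/
def Coloring.bottom (c : Coloring b.closure H) : List H := (c.level N).take N

theorem Coloring.exists_isColoring_closure (c : Coloring b.closure H) :
    c.bottom.length = N ∧ Colorable b.slices c.bottom c.bottom ∧
      c.level N = c.bottom ++ c.bottom.reverse ∧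
      ∃ ms₁ ms₂ ms₃, c.colors = ms₁ ++ ms₂ ++ ms₃ ∧
        IsColoring (closingCups N) [] ms₁ (c.bottom ++ c.bottom.reverse) ∧
        IsColoring b.slices (c.bottom ++ c.bottom.reverse) ms₂ (c.bottom ++ c.bottom.reverse) ∧
        IsColoring (closingCaps N) (c.bottom ++ c.bottom.reverse) ms₃ [] := by
  obtain ⟨_, ms₃, y, hc, h, hcaps⟩ := isColoring_append.1 c.isColoring
  obtain ⟨ms₁, ms₂, x, rfl, hcups, hbraid⟩ := isColoring_append.1 h
  obtain ⟨t, ht, rfl⟩ := colorable_closingCups.1 ⟨_, hcups⟩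
  obtain ⟨t', ht', rfl⟩ := colorable_closingCaps.1 ⟨_, hcaps⟩
  obtain ⟨t'', he, hfixed⟩ := (b.colorable_slices_append_right ht).1 ⟨_, hbraid⟩
  obtain ⟨rfl, hreverse⟩ := List.append_inj' he (by simp [ht, ht'])
  obtain rfl := List.reverse_injective hreverse
  have hlevel : c.level N = t' ++ t'.reverse := by
    rw [List.append_assoc] at hc
    simpa [closingCups] using c.level_length_eq hc hcups
  have hbottom : c.bottom = t' := by rw [bottom, hlevel, List.take_left' ht]
  rw [hbottom]
  exact ⟨ht, hfixed, hlevel, ms₁, ms₂, ms₃, hc, hcups, hbraid, hcaps⟩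

theorem Coloring.length_bottom (c : Coloring b.closure H) : c.bottom.length = N :=
  c.exists_isColoring_closure.1

theorem Coloring.colorable_bottom (c : Coloring b.closure H) :
    Colorable b.slices c.bottom c.bottom :=
  c.exists_isColoring_closure.2.1

theorem Coloring.level_eq_bottom_append (c : Coloring b.closure H) :
    c.level N = c.bottom ++ c.bottom.reverse :=
  c.exists_isColoring_closure.2.2.1

theorem Coloring.ext_bottom {c d : Coloring b.closure H} (h : c.bottom = d.bottom) : c = d := by
  obtain ⟨-, -, -, ms₁, ms₂, ms₃, hc, hcups, hbraid, hcaps⟩ := c.exists_isColoring_closure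
  obtain ⟨-, -, -, ns₁, ns₂, ns₃, hd, hcups', hbraid', hcaps'⟩ := d.exists_isColoring_closure
  rw [← h] at hcups' hbraid' hcaps'
  refine Coloring.ext ?_
  rw [hc, hd, (hcups.bottom_unique (fun _ => kind_ne_cap_of_mem_closingCups) hcups').1,
    (hbraid.top_unique (fun _ => b.kind_ne_cup_of_mem_slices) hbraid').1,
    (hcaps.top_unique (fun _ => kind_ne_cup_of_mem_closingCaps) hcaps').1]

theorem exists_coloring_bottom_eq {t : List H} (ht : t.length = N)
    (h : Colorable b.slices t t) : ∃ c : Coloring b.closure H, c.bottom = t := by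
  obtain ⟨ms₁, hcups⟩ := colorable_closingCups.2 ⟨t, ht, rfl⟩
  obtain ⟨ms₂, hbraid⟩ :=
    (b.colorable_slices_append_right (z := t.reverse) ht).2 ⟨t, rfl, h⟩
  obtain ⟨ms₃, hcaps⟩ := colorable_closingCaps.2 ⟨t, ht, rfl⟩
  let c : Coloring b.closure H := ⟨ms₁ ++ ms₂ ++ ms₃, (hcups.append hbraid).append hcaps⟩
  have hlevel : c.level N = t ++ t.reverse := by
    simpa [closingCups] using c.level_length_eq (List.append_assoc _ _ _) hcups
  exact ⟨c, by rw [Coloring.bottom, hlevel, List.take_left' ht]⟩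

theorem card_coloring_closure (b : BraidWord N) :
    Nat.card (Coloring b.closure H) =
      Nat.card {t : List.Vector H N // Colorable b.slices t.toList t.toList} := by
  refine Nat.card_congr (Equiv.ofBijective
    (fun c => ⟨⟨c.bottom, c.length_bottom⟩, c.colorable_bottom⟩) ⟨fun c d h => ?_, ?_⟩)
  · exact Coloring.ext_bottom (congrArg (fun t => t.1.1) h)
  · rintro ⟨⟨t, ht⟩, h⟩
    obtain ⟨c, rfl⟩ := exists_coloring_bottom_eq ht h
    exact ⟨c, rfl⟩

theorem Coloring.bottom_map {f : G → H} (hf : PreservesCore f) (c : Coloring b.closure G) :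
    (c.map hf).bottom = c.bottom.map f := by
  rw [bottom, level_map, bottom, List.map_take]

theorem Coloring.exists_map_subtype_eq (c : Coloring b.closure H) {R : Subgroup H}
    (h : ∀ a ∈ c.bottom, a ∈ R) :
    ∃ d : Coloring b.closure R, d.map (preservesCore_hom R.subtype) = c := by
  obtain ⟨t, ht⟩ : ∃ t : List R, t.map R.subtype = c.bottom := by
    lift c.bottom to List R using h with t
    exact ⟨t, rfl⟩
  have hlength : t.length = N := by rw [← c.length_bottom, ← ht, List.length_map]
  obtain ⟨y, ms, hy⟩ := b.exists_colorable hlength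
  have hmap : Colorable b.slices c.bottom (y.map R.subtype) :=
    ht ▸ ⟨_, hy.map (preservesCore_hom R.subtype)⟩
  have hty : t = y := List.map_injective_iff.2 R.subtype_injective
    (ht.trans (b.colorable_slices_unique c.colorable_bottom hmap))
  subst hty
  obtain ⟨d, hd⟩ := exists_coloring_bottom_eq hlength ⟨ms, hy⟩
  exact ⟨d, ext_bottom (by rw [bottom_map, hd, ht])⟩

end ClosedBraidColorings

/-! ### Colorings of the closure of `Δ₅⁴` -/

section DeltaFourth

variable {H : Type*} [Group H]

theorem colorable_five_strand_row (a b c d e : H) {y : List H} :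
    Colorable [cross 0 true, cross 1 true, cross 2 true, cross 3 true] [a, b, c, d, e] y ↔
      y = [a * b⁻¹ * a, a * c⁻¹ * a, a * d⁻¹ * a, a * e⁻¹ * a, a] := by
  have sliceRel_cross_succ {i : ℕ} {a : H} {x y : List H} :
      SliceRel (cross (i + 1) true) (a :: x) y ↔
        ∃ y', y = a :: y' ∧ SliceRel (cross i true) x y' := by
    simpa [Slice.shift, cross, add_comm] using sliceRel_append_left (s := cross i true) (p := [a])
  have sliceRel_cross_zero {a b : H} {q y : List H} :
      SliceRel (cross 0 true) (a :: b :: q) y ↔ y = (a * b⁻¹ * a) :: a :: q := by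
    simp [sliceRel_cross_zero_true]
  simp [sliceRel_cross_zero, sliceRel_cross_succ]

/-- The alternating product of the colors of five strands, by which a full twist acts on
colorings. -/
def alternatingProd (a b c d e : H) : H := a * b⁻¹ * c * d⁻¹ * e

theorem colorable_five_strand_full_twist (a b c d e : H) {y : List H} :
    Colorable (List.replicate 5 [cross 0 true, cross 1 true, cross 2 true, cross 3 true]).flatten
      [a, b, c, d, e] y ↔ y = [a, b, c, d, e].map fun x =>
        alternatingProd a b c d e * x⁻¹ * alternatingProd e d c b a := by
  simp only [List.replicate_succ, List.replicate_zero, List.flatten_cons, List.flatten_nil,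
    List.append_nil, colorable_append, colorable_five_strand_row, exists_eq_left]
  simp [alternatingProd, mul_assoc]

theorem alternatingProd_mul_inv_mul (a b c d e p q : H) :
    alternatingProd (p * a⁻¹ * q) (p * b⁻¹ * q) (p * c⁻¹ * q) (p * d⁻¹ * q) (p * e⁻¹ * q) =
      p * (alternatingProd e d c b a)⁻¹ * q := by
  simp [alternatingProd, mul_assoc]

theorem colorable_deltaFourth (a b c d e : H) {y : List H} :
    Colorable deltaFourth.slices [a, b, c, d, e] y ↔ y = [a, b, c, d, e].map fun x =>
      alternatingProd a b c d e * (alternatingProd e d c b a)⁻¹ * x *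
        (alternatingProd a b c d e)⁻¹ * alternatingProd e d c b a := by
  have two_full_twists : deltaFourth.slices =
      (List.replicate 5 [cross 0 true, cross 1 true, cross 2 true, cross 3 true]).flatten ++
        (List.replicate 5 [cross 0 true, cross 1 true, cross 2 true, cross 3 true]).flatten := by
    decide
  simp only [two_full_twists, colorable_append, colorable_five_strand_full_twist, exists_eq_left,
    List.map_cons, List.map_nil, alternatingProd_mul_inv_mul]
  simp only [mul_inv_rev, inv_inv, mul_assoc, mul_inv_cancel_left]

theorem wordP_eq_one_of_colorable {x y z t : H}
    (h : Colorable deltaFourth.slices [x, y, z, t, 1] [x, y, z, t, 1]) : wordP x y z t = 1 := by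
  simp only [colorable_deltaFourth, List.map_cons, List.map_nil, List.cons.injEq] at h
  calc wordP x y z t = alternatingProd x y z t 1 * (alternatingProd 1 t z y x)⁻¹ * t *
        (alternatingProd x y z t 1)⁻¹ * alternatingProd 1 t z y x * t⁻¹ := by
        simp [wordP, alternatingProd, mul_assoc]
    _ = 1 := by rw [← h.2.2.2.1, mul_inv_cancel]

theorem exists_eq_of_length_eq_five {α : Type*} {t : List α} (ht : t.length = 5) :
    ∃ a b c d e, t = [a, b, c, d, e] :=
  match t, ht with
  | [a, b, c, d, e], _ => ⟨a, b, c, d, e, rfl⟩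

theorem colorable_deltaFourth_of_comm {A : Type*} [CommGroup A] {t : List A}
    (ht : t.length = 5) : Colorable deltaFourth.slices t t := by
  obtain ⟨a, b, c, d, e, rfl⟩ := exists_eq_of_length_eq_five ht
  have hreverse : alternatingProd e d c b a = alternatingProd a b c d e := by
    simp only [alternatingProd]
    ac_rfl
  rw [colorable_deltaFourth, hreverse]
  simp

theorem card_vector_eq_pow (α : Type*) [Finite α] (n : ℕ) :
    Nat.card (List.Vector α n) = Nat.card α ^ n := by
  have := Fintype.ofFinite α
  rw [Nat.card_eq_fintype_card, Nat.card_eq_fintype_card, card_vector]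

theorem card_coloring_deltaFourth_of_comm (A : Type*) [CommGroup A] [Finite A] :
    Nat.card (Coloring deltaFourth.closure A) = Nat.card A ^ 5 := by
  rw [card_coloring_closure, ← card_vector_eq_pow]
  exact Nat.card_congr (Equiv.subtypeUnivEquiv fun v => colorable_deltaFourth_of_comm v.2)

theorem card_coloring_deltaFourth_lt [Finite H] {x y z t : H} (h : wordP x y z t ≠ 1) :
    Nat.card (Coloring deltaFourth.closure H) < Nat.card H ^ 5 := by
  rw [card_coloring_closure, ← card_vector_eq_pow]
  have := Fintype.ofFinite H
  exact Finite.card_subtype_lt (x := ⟨[x, y, z, t, 1], rfl⟩) (h ∘ wordP_eq_one_of_colorable)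

/-! #### Trivial links -/

theorem isColoring_trivialLink_succ {n : ℕ} {ms : List (List H)} :
    IsColoring (trivialLink (n + 1)).word [] ms [] ↔
      ∃ a ms', ms = [a, a] :: [] :: ms' ∧ IsColoring (trivialLink n).word [] ms' [] := by
  change IsColoring (cup 0 :: cap 0 :: (trivialLink n).word) [] ms [] ↔ _
  constructor
  · rintro (_ | ⟨hcup, _ | ⟨hcap, htail⟩⟩)
    obtain ⟨a, rfl⟩ := sliceRel_cup_zero.1 hcup
    obtain ⟨_, hm⟩ := sliceRel_cap_zero.1 hcap
    obtain ⟨-, -, rfl⟩ := by simpa only [List.cons.injEq] using hm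
    exact ⟨a, _, rfl, htail⟩
  · rintro ⟨a, ms', rfl, h⟩
    exact .cons (sliceRel_cup_zero.2 ⟨a, rfl⟩) (.cons (sliceRel_cap_zero.2 ⟨a, rfl⟩) h)

theorem card_coloring_trivialLink (n : ℕ) :
    Nat.card (Coloring (trivialLink n) H) = Nat.card H ^ n := by
  induction n with
  | zero =>
    have coloring_eq (c : Coloring (trivialLink 0) H) : c = ⟨[], .nil []⟩ := by
      obtain ⟨_, _ | _⟩ := c
      rfl
    have : Unique (Coloring (trivialLink 0) H) := ⟨⟨_⟩, coloring_eq⟩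
    rw [Nat.card_unique, pow_zero]
  | succ n ih =>
    rw [pow_succ', ← ih, ← Nat.card_prod]
    let addCircle (x : H × Coloring (trivialLink n) H) : Coloring (trivialLink (n + 1)) H :=
      ⟨[x.1, x.1] :: [] :: x.2.colors,
        isColoring_trivialLink_succ.2 ⟨x.1, _, rfl, x.2.isColoring⟩⟩
    refine (Nat.card_congr (Equiv.ofBijective addCircle ⟨?_, ?_⟩)).symm
    · rintro ⟨a, ms, _⟩ ⟨b, ms', _⟩ h
      obtain ⟨⟨rfl, -⟩, -, rfl⟩ := by
        simpa only [addCircle, Coloring.mk.injEq, List.cons.injEq] using h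
      rfl
    · rintro ⟨ms, h⟩
      obtain ⟨a, ms', rfl, h'⟩ := isColoring_trivialLink_succ.1 h
      exact ⟨⟨a, ms', h'⟩, rfl⟩

theorem not_card_coreBurnside_hom_eq (n : ℕ) :
    ¬ ∀ (H : Type) [Group H] [Finite H], (∀ h : H, h ^ 3 = 1) →
      Nat.card (CoreBurnside 3 deltaFourth.closure →* H) =
        Nat.card (CoreBurnside 3 (trivialLink n) →* H) := by
  intro h
  replace h (H : Type) [Group H] [Finite H] (hH : ∀ h : H, h ^ 3 = 1) :
      Nat.card (Coloring deltaFourth.closure H) = Nat.card H ^ n := by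
    rw [← card_coreBurnside_hom hH, h H hH, card_coreBurnside_hom hH, card_coloring_trivialLink]
  have components_eq_five : 5 = n := by
    have hcard : 2 ≤ Nat.card (Multiplicative (ZMod 3)) := by simp
    exact Nat.pow_right_injective hcard
      ((card_coloring_deltaFourth_of_comm _).symm.trans (h _ (by decide)))
  subst components_eq_five
  exact (card_coloring_deltaFourth_lt ExteriorAffine.wordP_ne_one).ne
    (h _ ExteriorAffine.pow_three_eq_one)

/-! #### The Burnside group as a quotient of `B(4, 3)` -/

theorem eq_top_of_map_subtype_eq_linkColoring {n : ℕ} {D : LinkDiagram} {e : Strand D}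
    {R : Subgroup (LinkBurnside n D e)} {c : Coloring D R}
    (hc : c.map (preservesCore_hom R.subtype) = linkColoring n e) : R = ⊤ := by
  have color_eq (p : Strand D) : R.subtype (c.color p) = linkArc n e p := by
    rw [← c.color_map (preservesCore_hom R.subtype), hc, linkColoring_color]
  have hR (r : R) : r ^ n = 1 := Subtype.ext (BurnsideQuotient.pow_eq_one r.1)
  have hsection : R.subtype.comp (c.linkHom hR e) = .id _ := linkBurnside_hom_ext fun p => by
    rw [MonoidHom.comp_apply, Coloring.linkHom_linkArc, map_mul, map_inv, color_eq, color_eq,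
      linkArc_self, inv_one, one_mul, MonoidHom.id_apply]
  refine eq_top_iff.2 fun x _ => ?_
  rw [← MonoidHom.id_apply _ x, ← hsection]
  exact (c.linkHom hR e x).2

/-- The rightmost strand at the bottom of the braid `Δ₅⁴`. -/
def deltaFourthStrand : Strand deltaFourth.closure := ⟨5, 4, 10, by decide, by decide⟩

theorem exists_linkColoring_deltaFourth_bottom_eq (n : ℕ) :
    ∃ x y z t, (linkColoring n deltaFourthStrand).bottom = [x, y, z, t, 1] := by
  set c := linkColoring n deltaFourthStrand
  obtain ⟨x, y, z, t, s, hbottom⟩ := exists_eq_of_length_eq_five c.length_bottom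
  have hcolor := c.getElem?_level deltaFourthStrand
  rw [linkColoring_color, linkArc_self] at hcolor
  change (c.level 5)[4]? = _ at hcolor
  rw [c.level_eq_bottom_append, hbottom] at hcolor
  obtain rfl : s = 1 := Option.some_injective _ hcolor
  exact ⟨x, y, z, t, hbottom⟩

theorem exists_surjective_deltaFourth : ∃ (e : Strand deltaFourth.closure)
    (φ : FreeBurnside 4 3 →* LinkBurnside 3 deltaFourth.closure e),
    Function.Surjective φ ∧ φ elementP = 1 := by
  obtain ⟨x, y, z, t, hbottom⟩ := exists_linkColoring_deltaFourth_bottom_eq 3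
  obtain ⟨φ, hφ⟩ := FreeBurnside.exists_hom BurnsideQuotient.pow_eq_one ![x, y, z, t]
  have mem_range : ∀ a ∈ [x, y, z, t, 1], a ∈ φ.range := by
    simp only [List.forall_mem_cons, List.not_mem_nil, false_imp_iff, implies_true, and_true]
    exact ⟨⟨_, hφ 0⟩, ⟨_, hφ 1⟩, ⟨_, hφ 2⟩, ⟨_, hφ 3⟩, one_mem _⟩
  obtain ⟨c, hc⟩ := (linkColoring 3 deltaFourthStrand).exists_map_subtype_eq (hbottom ▸ mem_range)
  refine ⟨deltaFourthStrand, φ,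
    MonoidHom.range_eq_top.1 (eq_top_of_map_subtype_eq_linkColoring hc), ?_⟩
  rw [map_elementP hφ]
  exact wordP_eq_one_of_colorable (hbottom ▸ Coloring.colorable_bottom _)

end DeltaFourth

end LinkDiag

open LinkDiag in
theorem mainTheorem7 :
    -- Chen's link is 3-move equivalent to the closure of `Δ₅⁴`
    MoveEquiv 3 chenLink deltaFourth.closure ∧
    -- the third Burnside group is invariant under 3-moves, in the unreduced version,
    -- and in the reduced version whatever arcs are put equal to `1`
    (∀ D E : LinkDiagram, MoveEquiv 3 D E →
      Nonempty (CoreBurnside 3 D ≃* CoreBurnside 3 E) ∧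
      ∀ (d : Strand D) (e : Strand E), Nonempty (LinkBurnside 3 D d ≃* LinkBurnside 3 E e)) ∧
    -- `P` is nontrivial in `B(4,3)`, but it dies in the Burnside group of Chen's link,
    -- which is a quotient of `B(4,3)`
    elementP ≠ 1 ∧
    (∀ e : Strand chenLink, ∃ φ : FreeBurnside 4 3 →* LinkBurnside 3 chenLink e,
      Function.Surjective φ ∧ φ elementP = 1) ∧
    -- the third Burnside group of Chen's link differs from that of any trivial link
    (∀ n : ℕ, IsEmpty (CoreBurnside 3 chenLink ≃* CoreBurnside 3 (trivialLink n)) ∧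
      ∀ (d : Strand chenLink) (e : Strand (trivialLink n)),
        IsEmpty (LinkBurnside 3 chenLink d ≃* LinkBurnside 3 (trivialLink n) e)) ∧
    -- Chen's link is not 3-move equivalent to a trivial link
    (∀ n : ℕ, ¬ MoveEquiv 3 chenLink (trivialLink n)) ∧
    -- the Montesinos–Nakanishi conjecture fails
    ¬ ∀ D : LinkDiagram, ∃ n : ℕ, MoveEquiv 3 D (trivialLink n) := by
  have hinv : ∀ D E : LinkDiagram, MoveEquiv 3 D E →
      Nonempty (CoreBurnside 3 D ≃* CoreBurnside 3 E) ∧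
      ∀ (d : Strand D) (e : Strand E), Nonempty (LinkBurnside 3 D d ≃* LinkBurnside 3 E e) :=
    fun D E h => ⟨(h.burnside_equiv (by decide)).1, (h.burnside_equiv (by decide)).2.1⟩
  obtain ⟨⟨f⟩, hred⟩ := hinv _ _ moveEquiv_chenLink
  obtain ⟨e₀, φ, hφ, hP⟩ := exists_surjective_deltaFourth
  have hcore : ∀ n : ℕ, IsEmpty (CoreBurnside 3 chenLink ≃* CoreBurnside 3 (trivialLink n)) := by
    refine fun n => ⟨fun g => not_card_coreBurnside_hom_eq n fun H _ _ _ => ?_⟩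
    exact Nat.card_congr (f.symm.trans g).monoidHomCongrLeftEquiv
  have hmove : ∀ n : ℕ, ¬ MoveEquiv 3 chenLink (trivialLink n) := fun n h =>
    (hcore n).elim (hinv _ _ h).1.some
  refine ⟨moveEquiv_chenLink, hinv, elementP_ne_one, fun e => ?_, fun n => ⟨hcore n, ?_⟩, hmove,
    fun h => ?_⟩
  · obtain ⟨g⟩ := hred e e₀
    exact ⟨g.symm.toMonoidHom.comp φ, g.symm.surjective.comp hφ, by simp [hP]⟩
  · refine fun d e => ⟨fun g => not_card_coreBurnside_hom_eq n fun H _ _ hH => ?_⟩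
    obtain ⟨g₀⟩ := hred d e₀
    rw [card_coreBurnside_hom_eq_mul hH e₀, card_coreBurnside_hom_eq_mul hH e,
      Nat.card_congr (g₀.symm.trans g).monoidHomCongrLeftEquiv]
  · obtain ⟨n, hn⟩ := h chenLink
    exact hmove n hn
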